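/- Let $X,Y$ be Banach spaces over $\mathbb{K}\in\{\mathbb{R},\mathbb{C}\}$, let $T:X\to Y$ be a bounded linear operator with adjoint $T^*:Y^*\to X^*$, let $1\le p<\infty$, and let $p^*\in(1,\infty]$ be given by $\frac1p+\frac1{p^*}=1$. For a Banach space $Z$ consider the following spaces of sequences in $Z$: - $\ell_r(Z)$, $1\le r\le\infty$: the sequences with $\sum_j\|z_j\|^r<\infty$, normed by $\big(\sum_j\|z_j\|^r\big)^{1/r}$ (for $r=\infty$: bounded sequences with the supremum norm); - $\ell_p^{w}(Z)$: the sequences with $\sum_j|\varphi(z_j)|^p<\infty$ for all $\varphi\in Z^*$, normed by $\sup_{\|\varphi\|\le1}\big(\sum_j|\varphi(z_j)|^p\big)^{1/p}$; - $\ell_p^{mid}(Z)$: the sequences with $\sum_n\sum_j|\varphi_n(z_j)|^p<\infty$ for all $(\varphi_n)_n\in\ell_p^w(Z^*)$, normed by the supremum of $\big(\sum_n\sum_j|\varphi_n(z_j)|^p\big)^{1/p}$ over the closed unit ball of $\ell_p^w(Z^*)$; - $(\ell_p^{mid})^{dual}(Z)$: the sequences with $\sum_j|\varphi_j(z_j)|<\infty$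 for all $(\varphi_j)_j\in\ell_p^{mid}(Z^*)$, normed by the supremum of $\sum_j|\varphi_j(z_j)|$ over the closed unit ball of $\ell_p^{mid}(Z^*)$. For a bounded linear operator $S$ write $\hat S$ for the map $(z_j)_j\mapsto(Sz_j)_j$. The operator $S:Z\to W$ is absolutely mid $p$-summing if $\hat S:\ell_p^{mid}(Z)\to\ell_p(W)$ is well defined and continuous; then $\pi_p^{mid}(S)<\infty$ denotes the operator norm of this map. (i) The map $\hat{T^*}:\ell_{p^*}(Y^*)\to(\ell_p^{mid})^{dual}(X^*)$ is well defined and continuous if and only if $T$ is absolutely mid $p$-summing. In this case $\pi_p^{mid}(T)=\|\hat{T^*}\|$. (ii) The map $\hat T:\ell_{p^*}(X)\to(\ell_p^{mid})^{dual}(Y)$ is well defined and continuous if and only if $T^*$ is absolutely mid $p$-summing. In this case $\pi_p^{mid}(T^*)=\|\hat T\|$. -/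

import Mathlib

open scoped NNReal ENNReal

/-- A space of `X`-valued sequences: the set of its members and its norm. The norm is recorded as
an extended nonnegative number, so that the (possibly divergent) sums and suprema that define it
carry no default values. -/
structure SeqSpace (X : Type*) where
  /-- the sequences that belong to the space -/
  mem : Set (ℕ → X)
  /-- the norm -/
  nrm : (ℕ → X) → ℝ≥0∞

namespace SeqSpace

/-- The closed unit ball. -/
def unitBall {X : Type*} (A : SeqSpace X) : Set (ℕ → X) :=
  {x | x ∈ A.mem ∧ A.nrm x ≤ 1}

section Spaces

variable (𝕜 : Type*) [RCLike 𝕜] (X : Type*) [NormedAddCommGroup X] [NormedSpace 𝕜 X]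

/-- The space `ℓ_q(X)` of absolutely `q`-summable sequences, `1 ≤ q ≤ ∞` (bounded sequences with
the supremum norm for `q = ∞`). -/
noncomputable def strong (q : ℝ≥0∞) (X : Type*) [NormedAddCommGroup X] : SeqSpace X where
  mem := {x | Memℓp x q}
  nrm x := if q = ∞ then ⨆ j, ‖x j‖ₑ else (∑' j, ‖x j‖ₑ ^ q.toReal) ^ (1 / q.toReal)

/-- The space `ℓ_p^w(X)` of weakly `p`-summable sequences, `1 ≤ p < ∞`. -/
noncomputable def weak (p : ℝ≥0) : SeqSpace X where
  mem := {x | ∀ φ : StrongDual 𝕜 X, ∑' j, ‖φ (x j)‖ₑ ^ (p : ℝ) < ∞}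
  nrm x := ⨆ (φ : StrongDual 𝕜 X) (_ : ‖φ‖ ≤ 1), (∑' j, ‖φ (x j)‖ₑ ^ (p : ℝ)) ^ (1 / (p : ℝ))

/-- The space `ℓ_p^mid(X)` of mid `p`-summable sequences, `1 ≤ p < ∞`. -/
noncomputable def mid (p : ℝ≥0) : SeqSpace X where
  mem := {x | ∀ φ ∈ (weak 𝕜 (StrongDual 𝕜 X) p).mem,
    ∑' n, ∑' j, ‖φ n (x j)‖ₑ ^ (p : ℝ) < ∞}
  nrm x := ⨆ φ ∈ (weak 𝕜 (StrongDual 𝕜 X) p).unitBall,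
    (∑' n, ∑' j, ‖φ n (x j)‖ₑ ^ (p : ℝ)) ^ (1 / (p : ℝ))

/-- The dual sequence space `(ℓ_p^mid)^dual(X)`, `1 ≤ p < ∞`. -/
noncomputable def midDual (p : ℝ≥0) : SeqSpace X where
  mem := {x | ∀ φ ∈ (mid 𝕜 (StrongDual 𝕜 X) p).mem, ∑' j, ‖φ j (x j)‖ₑ < ∞}
  nrm x := ⨆ φ ∈ (mid 𝕜 (StrongDual 𝕜 X) p).unitBall, ∑' j, ‖φ j (x j)‖ₑ

end Spaces

section Maps

variable {X Y : Type*} [AddGroup X] [AddGroup Y]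

/-- The map `T̂ : A → B`, `(x_j) ↦ (T x_j)`, is well defined and continuous for the norms of `A`
and `B`. -/
def InducesContinuous (A : SeqSpace X) (B : SeqSpace Y) (T : X → Y) : Prop :=
  (∀ x ∈ A.mem, (fun j => T (x j)) ∈ B.mem) ∧
  ∀ x ∈ A.mem, ∀ ε : ℝ≥0∞, 0 < ε → ∃ δ : ℝ≥0∞, 0 < δ ∧
    ∀ y ∈ A.mem, A.nrm (fun j => y j - x j) < δ → B.nrm (fun j => T (y j) - T (x j)) < ε

/-- The operator norm of `T̂ : A → B`: the supremum of `‖T̂ x‖` over the closed unit ball of `A`. -/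
noncomputable def opNorm (A : SeqSpace X) (B : SeqSpace Y) (T : X → Y) : ℝ≥0∞ :=
  ⨆ x ∈ A.unitBall, B.nrm (fun j => T (x j))

end Maps

end SeqSpace

section MidSumming

variable {𝕜 : Type*} [RCLike 𝕜] {X Y : Type*} [NormedAddCommGroup X] [NormedSpace 𝕜 X]
  [NormedAddCommGroup Y] [NormedSpace 𝕜 Y]

/-- The bounded operator `T` is absolutely mid `p`-summing: `T̂ : ℓ_p^mid(X) → ℓ_p(Y)` is well
defined and continuous. -/
def IsAbsMidSumming (p : ℝ≥0) (T : X →L[𝕜] Y) : Prop :=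
  (SeqSpace.mid 𝕜 X p).InducesContinuous (SeqSpace.strong p Y) T

/-- The norm `π_p^mid(T) = ‖T̂ : ℓ_p^mid(X) → ℓ_p(Y)‖`. -/
noncomputable def piMid (p : ℝ≥0) (T : X →L[𝕜] Y) : ℝ≥0∞ :=
  (SeqSpace.mid 𝕜 X p).opNorm (SeqSpace.strong p Y) T

/-- The Banach space adjoint `T* : Y* → X*`, `f ↦ f ∘ T`. -/
noncomputable def banachAdjoint (T : X →L[𝕜] Y) : StrongDual 𝕜 Y →L[𝕜] StrongDual 𝕜 X :=
  T.precomp 𝕜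

end MidSumming

/-! The norm of `ℓ_p(X*)` is the supremum of `∑ ‖g j (x j)‖` over the unit ball of `ℓ_q(X)`
(`iSup_tsum_enorm_apply_eq_nrm_strong`). Since `φ (T x) = (T* φ) x`, exchanging the suprema over `φ`
and `x` gives `‖T̂ : ℓ_q(X) → (ℓ_p^mid)^dual(Y)‖ = π(T*)`, which is (ii). Applied to `T*`, the same
identity turns (i) into `π(T**) = π(T)`, the real content of the theorem.

One inequality comes from the canonical embedding `X → X**`. For the other, a finite tuple of
functionals `f i = s i • T* (y i)`, with unimodular `s i`, defines a functional on `X ^ M` bounded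
by `π(T)` times the mid norm, and the bound has to survive when `X` is replaced by `X**`
(`norm_sum_bidual_apply_le`). Up to a factor `θ < 1`, the mid norm on `X ^ M` is the support
function of a set of functionals `∑ k, ∑ i, e k i * χ k (z i)`. Here the `e k` are finitely many
vectors norming `ℓ_p^M` up to `θ`, and `χ k = w k ^ (p - 1) • ψ k` with `∑ w k ^ p ≤ 1` and `ψ` of
weak `ℓ_p`-norm at most one.

The set of admissible weights and `χ` is convex and weak* compact, so Hahn–Banach represents `f`
exactly, up to the scalar `C / θ`, by finitely many `ψ k` in `X*`. Such a formula can be evaluated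
at `ξ` in `X**`, and Hölder's inequality bounds the result by the mid norm of `ξ` tested on the `ψ
k`. Then `θ` tends to `1`. -/

/-! ### Duality for finite-dimensional `ℓ_p` -/

/-- A tangent-line form of Young's inequality. -/
theorem Real.mul_rpow_sub_one_mul_le {p s a : ℝ} (hp : 1 ≤ p) (hs : 0 ≤ s) (ha : 0 ≤ a) :
    p * s ^ (p - 1) * a ≤ (p - 1) * s ^ p + a ^ p := by
  rcases hp.eq_or_lt with rfl | hp
  · simp
  · have hp0 : 0 < p - 1 := by linarith
    have h := Real.young_inequality_of_nonneg ha (Real.rpow_nonneg hs (p - 1))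
      (Real.HolderConjugate.conjExponent hp)
    rw [← Real.rpow_mul hs] at h
    have e : (p - 1) * p.conjExponent = p := by
      rw [Real.conjExponent]; field_simp
    rw [e, Real.conjExponent] at h
    have h2 := mul_le_mul_of_nonneg_left h (by linarith : 0 ≤ p)
    have e2 : p * (a ^ p / p + s ^ p / (p / (p - 1))) = (p - 1) * s ^ p + a ^ p := by
      field_simp; ring
    rw [e2] at h2
    linarith [h2]

/-- Hölder's inequality with the dual vector written as `t ^ (p - 1)`. At `p = 1` this vector is
constantly `1`, also where `t` vanishes, so the conjugate exponent `∞` needs no separate treatment.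
-/
theorem Real.sum_rpow_sub_one_mul_le {ι : Type*} [Fintype ι] {p : ℝ} (hp : 1 ≤ p) {t u : ι → ℝ}
    (ht : ∀ i, 0 ≤ t i) (hu : ∀ i, 0 ≤ u i) (h1 : ∑ i, t i ^ p ≤ 1) :
    ∑ i, t i ^ (p - 1) * u i ≤ (∑ i, u i ^ p) ^ (1 / p) := by
  have hp0 : 0 < p := by linarith
  have hS : 0 ≤ ∑ i, u i ^ p := Finset.sum_nonneg fun i _ => Real.rpow_nonneg (hu i) p
  rcases hS.eq_or_lt with h0 | hS
  · have hz : ∀ i, u i = 0 := fun i => by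
      have := (Finset.sum_eq_zero_iff_of_nonneg fun i _ => Real.rpow_nonneg (hu i) p).1 h0.symm i
        (Finset.mem_univ i)
      exact (Real.rpow_eq_zero (hu i) hp0.ne').1 this
    simp only [hz, mul_zero, Finset.sum_const_zero]
    exact Real.rpow_nonneg (by simp [Real.zero_rpow hp0.ne']) _
  · set B := (∑ i, u i ^ p) ^ (1 / p) with hB
    have hB0 : 0 < B := Real.rpow_pos_of_pos hS _
    have hBp : B ^ p = ∑ i, u i ^ p := by
      rw [hB, ← Real.rpow_mul hS.le, one_div_mul_cancel hp0.ne', Real.rpow_one]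
    have key : ∀ i, p * (t i ^ (p - 1) * u i) ≤ ((p - 1) * t i ^ p + u i ^ p / B ^ p) * B := by
      intro i
      have := Real.mul_rpow_sub_one_mul_le hp (ht i) (div_nonneg (hu i) hB0.le)
      rw [Real.div_rpow (hu i) hB0.le] at this
      have := mul_le_mul_of_nonneg_right this hB0.le
      refine le_trans (le_of_eq ?_) this
      field_simp
    have hsum := Finset.sum_le_sum fun i (_ : i ∈ Finset.univ) => key i
    rw [← Finset.mul_sum, ← Finset.sum_mul, Finset.sum_add_distrib, ← Finset.mul_sum,
      ← Finset.sum_div, hBp, div_self hS.ne'] at hsum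
    have : ((p - 1) * ∑ i, t i ^ p + 1) * B ≤ p * B := by
      apply mul_le_mul_of_nonneg_right _ hB0.le
      nlinarith
    exact le_of_mul_le_mul_left (hsum.trans this) hp0

theorem Real.exists_sum_mul_rpow_sub_one_eq {ι : Type*} [Fintype ι] {p : ℝ} (hp : 1 ≤ p)
    {a : ι → ℝ} (ha : ∀ i, 0 ≤ a i) :
    ∃ t : ι → ℝ, (∀ i, 0 ≤ t i) ∧ ∑ i, t i ^ p ≤ 1 ∧
      ∑ i, t i ^ (p - 1) * a i = (∑ i, a i ^ p) ^ (1 / p) := by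
  have hp0 : 0 < p := by linarith
  have hS : 0 ≤ ∑ i, a i ^ p := Finset.sum_nonneg fun i _ => Real.rpow_nonneg (ha i) p
  rcases hS.eq_or_lt with h0 | hS
  · have hz : ∀ i, a i = 0 := fun i => by
      have := (Finset.sum_eq_zero_iff_of_nonneg fun i _ => Real.rpow_nonneg (ha i) p).1 h0.symm i
        (Finset.mem_univ i)
      exact (Real.rpow_eq_zero (ha i) hp0.ne').1 this
    refine ⟨0, fun _ => le_rfl, by simp [Real.zero_rpow hp0.ne'], ?_⟩
    rw [← h0]
    simp [hz, Real.zero_rpow (inv_ne_zero hp0.ne')]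
  · set B := (∑ i, a i ^ p) ^ (1 / p) with hB
    have hB0 : 0 < B := Real.rpow_pos_of_pos hS _
    have hBp : B ^ p = ∑ i, a i ^ p := by
      rw [hB, ← Real.rpow_mul hS.le, one_div_mul_cancel hp0.ne', Real.rpow_one]
    refine ⟨fun i => a i / B, fun i => div_nonneg (ha i) hB0.le, ?_, ?_⟩
    · simp only [Real.div_rpow (ha _) hB0.le]
      rw [← Finset.sum_div, hBp, div_self hS.ne']
    · have : ∀ i, (a i / B) ^ (p - 1) * a i = a i ^ p / B ^ p * B := by
        intro i
        rcases (ha i).eq_or_lt with h | h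
        · simp [← h, Real.zero_rpow hp0.ne']
        · rw [Real.div_rpow h.le hB0.le, Real.rpow_sub_one h.ne', Real.rpow_sub_one hB0.ne']
          field_simp
      simp only [this]
      rw [← Finset.sum_mul, ← Finset.sum_div, hBp, div_self hS.ne', one_mul]

theorem RCLike.exists_norm_one_mul_eq {𝕜 : Type*} [RCLike 𝕜] (z : 𝕜) :
    ∃ s : 𝕜, ‖s‖ = 1 ∧ s * z = (‖z‖ : 𝕜) := by
  rcases eq_or_ne z 0 with rfl | hz
  · exact ⟨1, by simp⟩
  · refine ⟨(‖z‖ : 𝕜) / z, ?_, div_mul_cancel₀ _ hz⟩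
    rw [norm_div, RCLike.norm_ofReal, abs_norm, div_self (norm_ne_zero_iff.2 hz)]

theorem RCLike.exists_sum_mul_eq {𝕜 ι : Type*} [RCLike 𝕜] [Fintype ι] {p : ℝ} (hp : 1 ≤ p)
    (v : ι → 𝕜) :
    ∃ e : ι → 𝕜, (∀ u : ι → 𝕜, ‖∑ i, e i * u i‖ ≤ (∑ i, ‖u i‖ ^ p) ^ (1 / p)) ∧
      ∑ i, e i * v i = (((∑ i, ‖v i‖ ^ p) ^ (1 / p) : ℝ) : 𝕜) := by
  obtain ⟨t, ht, ht1, hv⟩ := Real.exists_sum_mul_rpow_sub_one_eq hp fun i => norm_nonneg (v i)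
  choose s hs1 hs using fun i => RCLike.exists_norm_one_mul_eq (v i)
  refine ⟨fun i => ((t i ^ (p - 1) : ℝ) : 𝕜) * s i, fun u => ?_, ?_⟩
  · refine (norm_sum_le _ _).trans (le_trans (le_of_eq ?_)
      (Real.sum_rpow_sub_one_mul_le hp ht (fun i => norm_nonneg (u i)) ht1))
    refine Finset.sum_congr rfl fun i _ => ?_
    rw [norm_mul, norm_mul, hs1, mul_one, RCLike.norm_ofReal,
      abs_of_nonneg (Real.rpow_nonneg (ht i) _)]
  · rw [← hv]
    push_cast
    exact Finset.sum_congr rfl fun i _ => by rw [mul_assoc, hs]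

/-- Finitely many functionals in the dual ball of `ℓ_p^ι` norm it up to the factor `θ < 1`. -/
theorem RCLike.exists_finite_norming {𝕜 ι : Type*} [RCLike 𝕜] [Fintype ι] {p : ℝ} (hp : 1 ≤ p)
    {θ : ℝ} (hθ : θ < 1) :
    ∃ (N : ℕ) (e : Fin N → ι → 𝕜),
      (∀ k (u : ι → 𝕜), ‖∑ i, e k i * u i‖ ≤ (∑ i, ‖u i‖ ^ p) ^ (1 / p)) ∧
      ∀ v : ι → 𝕜, ∃ k, θ * (∑ i, ‖v i‖ ^ p) ^ (1 / p) ≤ ‖∑ i, e k i * v i‖ := by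
  classical
  have hp0 : 0 < p := by linarith
  have coord : ∀ (u : ι → 𝕜) i, ‖u i‖ ≤ (∑ i, ‖u i‖ ^ p) ^ (1 / p) := by
    intro u i
    have h : ‖u i‖ ^ p ≤ ∑ i, ‖u i‖ ^ p :=
      Finset.single_le_sum (f := fun i => ‖u i‖ ^ p)
        (fun i _ => Real.rpow_nonneg (norm_nonneg _) p) (Finset.mem_univ i)
    have := Real.rpow_le_rpow (Real.rpow_nonneg (norm_nonneg _) p) h (one_div_pos.2 hp0).le
    rwa [← Real.rpow_mul (norm_nonneg _), mul_one_div_cancel hp0.ne', Real.rpow_one] at this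
  set B : Set (ι → 𝕜) := {e | ∀ u : ι → 𝕜, ‖∑ i, e i * u i‖ ≤ (∑ i, ‖u i‖ ^ p) ^ (1 / p)} with hB
  have hBsub : B ⊆ Metric.closedBall 0 1 := by
    intro e he
    rw [mem_closedBall_zero_iff, pi_norm_le_iff_of_nonneg zero_le_one]
    intro i
    have := he (Pi.single i 1)
    have e1 : ∑ j, ‖(Pi.single i 1 : ι → 𝕜) j‖ ^ p = 1 := by
      rw [Finset.sum_eq_single i]
      · simp
      · intro j _ hj
        simp [hj, Real.zero_rpow hp0.ne']
      · simp
    rw [e1, Real.one_rpow] at this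
    simpa [Pi.single_apply] using this
  have htb : TotallyBounded B := (isCompact_closedBall (0 : ι → 𝕜) 1).totallyBounded.subset hBsub
  -- A sup-norm error of this size, summed over all coordinates, costs at most `(1 - θ) * A`; the `+
  -- 1` covers an empty index type.
  have hε : 0 < (1 - θ) / (Fintype.card ι + 1) := div_pos (by linarith) (by positivity)
  obtain ⟨F, hFB, hF, hcov⟩ := Metric.finite_approx_of_totallyBounded htb _ hε
  obtain ⟨N, g, hg⟩ := hF.fin_param
  have hgF : ∀ k, g k ∈ F := fun k => hg.2 ▸ Set.mem_range_self k
  refine ⟨N, g, fun k => hFB (hgF k), fun v => ?_⟩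
  obtain ⟨e, he, hev⟩ := RCLike.exists_sum_mul_eq (𝕜 := 𝕜) hp v
  obtain ⟨e', he', hd⟩ := Set.mem_iUnion₂.1 (hcov he)
  obtain ⟨k, rfl⟩ : e' ∈ Set.range g := hg.2.symm ▸ he'
  refine ⟨k, ?_⟩
  set A := (∑ i, ‖v i‖ ^ p) ^ (1 / p) with hA
  have hA0 : 0 ≤ A := Real.rpow_nonneg (Finset.sum_nonneg fun i _ =>
    Real.rpow_nonneg (norm_nonneg _) p) _
  have h1 : ‖∑ i, (e i - g k i) * v i‖ ≤ (1 - θ) * A := by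
    calc ‖∑ i, (e i - g k i) * v i‖
        ≤ ∑ i : ι, (1 - θ) / (Fintype.card ι + 1) * A := by
          refine (norm_sum_le _ _).trans (Finset.sum_le_sum fun i _ => ?_)
          rw [norm_mul]
          refine mul_le_mul ?_ (coord v i) (norm_nonneg _) hε.le
          have := (dist_le_pi_dist e (g k) i).trans (Metric.mem_ball.1 hd).le
          rwa [dist_eq_norm] at this
      _ = (Fintype.card ι / (Fintype.card ι + 1)) * ((1 - θ) * A) := by
          rw [Finset.sum_const, Finset.card_univ, nsmul_eq_mul]; ring
      _ ≤ 1 * ((1 - θ) * A) := by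
          apply mul_le_mul_of_nonneg_right _ (mul_nonneg (by linarith) hA0)
          rw [div_le_one (by positivity)]; linarith
      _ = _ := one_mul _
  have h2 : ∑ i, (e i - g k i) * v i = (A : 𝕜) - ∑ i, g k i * v i := by
    rw [← hev, ← Finset.sum_sub_distrib]
    exact Finset.sum_congr rfl fun i _ => by ring
  rw [h2] at h1
  have h3 := norm_sub_norm_le (A : 𝕜) (∑ i, g k i * v i)
  rw [RCLike.norm_ofReal, abs_of_nonneg hA0] at h3
  linarith

/-! ### Weak `ℓ_p`-norms of functionals and separation -/

section

variable {𝕜 X : Type*} [RCLike 𝕜] [NormedAddCommGroup X] [NormedSpace 𝕜 X]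

/-- A finite family of functionals whose weak `ℓ_p`-norm, tested on `X`, is at most one has weak
`ℓ_p`-norm at most one when tested on the bidual. -/
theorem StrongDual.sum_norm_bidual_rpow_le {κ : Type*} [Fintype κ] {p : ℝ} (hp : 1 ≤ p)
    {ψ : κ → StrongDual 𝕜 X} (h : ∀ x, ∑ k, ‖ψ k x‖ ^ p ≤ ‖x‖ ^ p)
    (ξ : StrongDual 𝕜 (StrongDual 𝕜 X)) : ∑ k, ‖ξ (ψ k)‖ ^ p ≤ ‖ξ‖ ^ p := by
  have hp0 : 0 < p := by linarith
  have hS : ∀ u : κ → 𝕜, 0 ≤ ∑ k, ‖u k‖ ^ p := fun u =>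
    Finset.sum_nonneg fun i _ => Real.rpow_nonneg (norm_nonneg _) p
  obtain ⟨e, he, hev⟩ := RCLike.exists_sum_mul_eq hp fun k => ξ (ψ k)
  -- An `ℓ_p` sum is a single linear combination with dual coefficients `e`, and the norm of that
  -- combination in `X*` is already determined on `X`.
  have h1 : ‖∑ k, e k • ψ k‖ ≤ 1 := by
    refine ContinuousLinearMap.opNorm_le_bound _ zero_le_one fun x => ?_
    have h2 : (∑ k, e k • ψ k) x = ∑ k, e k * ψ k x := by
      simp
    rw [h2, one_mul]
    refine (he fun k => ψ k x).trans ?_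
    have := Real.rpow_le_rpow (hS _) (h x) (one_div_pos.2 hp0).le
    rwa [← Real.rpow_mul (norm_nonneg _), mul_one_div_cancel hp0.ne', Real.rpow_one] at this
  have h3 : ‖ξ (∑ k, e k • ψ k)‖ ≤ ‖ξ‖ := (ξ.le_opNorm _).trans
    (mul_le_of_le_one_right (norm_nonneg _) h1)
  have h4 : ξ (∑ k, e k • ψ k) = ∑ k, e k * ξ (ψ k) := by simp [map_sum]
  rw [h4, hev, RCLike.norm_ofReal, abs_of_nonneg (Real.rpow_nonneg (hS _) _)] at h3
  have := Real.rpow_le_rpow (Real.rpow_nonneg (hS _) _) h3 hp0.le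
  rwa [← Real.rpow_mul (hS _), one_div_mul_cancel hp0.ne', Real.rpow_one] at this

end

/-- A functional dominated by the support function of a weakly compact convex set of functionals
belongs to this set. -/
theorem mem_of_re_le_of_isCompact {𝕜 Z : Type*} [RCLike 𝕜] [AddCommGroup Z] [Module 𝕜 Z]
    {S : Set (WeakBilin (LinearMap.id : (Z →ₗ[𝕜] 𝕜) →ₗ[𝕜] Z →ₗ[𝕜] 𝕜))}
    (hconv : Convex ℝ S) (hcomp : IsCompact S) (f : Z →ₗ[𝕜] 𝕜)
    (h : ∀ (z : Z) (r : ℝ), (∀ s : Z →ₗ[𝕜] 𝕜, s ∈ S → RCLike.re (s z) ≤ r) →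
      RCLike.re (f z) ≤ r) : f ∈ S := by
  by_contra hf
  have : T2Space (WeakBilin (LinearMap.id : (Z →ₗ[𝕜] 𝕜) →ₗ[𝕜] Z →ₗ[𝕜] 𝕜)) :=
    (WeakBilin.isEmbedding (B := (LinearMap.id : (Z →ₗ[𝕜] 𝕜) →ₗ[𝕜] Z →ₗ[𝕜] 𝕜))
      Function.injective_id).t2Space
  obtain ⟨g, u, hg, hu⟩ := RCLike.geometric_hahn_banach_closed_point (𝕜 := 𝕜) hconv
    hcomp.isClosed hf
  obtain ⟨z, rfl⟩ := LinearMap.dualEmbedding_surjective _ g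
  exact absurd (h z u fun s hs => (hg s hs).le) (not_le.2 hu)

/-! ### The convex compact set of weighted families -/

section

variable {𝕜 X κ ι : Type*} [RCLike 𝕜] [NormedAddCommGroup X] [NormedSpace 𝕜 X] [Fintype κ]
  [Fintype ι]

variable (𝕜 X κ) in
/-- Pairs of a weight `w` with `∑ w k ≤ 1` and a family of functionals `χ` such that
`∑ w k ^ (1 - p) * ‖χ k x‖ ^ p ≤ 1` for `‖x‖ ≤ 1`; the latter condition is written in its
Legendre dual form, which is jointly convex and closed. -/
def weightedFamilies (p : ℝ) : Set ((κ → ℝ) × (κ → WeakDual 𝕜 X)) :=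
  {c | (∀ k, 0 ≤ c.1 k) ∧ ∑ k, c.1 k ≤ 1 ∧ (∀ k x, ‖c.2 k x‖ ≤ ‖x‖) ∧
    ∀ x, ‖x‖ ≤ 1 → ∀ t : κ → ℝ, (∀ k, 0 ≤ t k) →
      ∑ k, (p * t k ^ (p - 1) * ‖c.2 k x‖ - (p - 1) * t k ^ p * c.1 k) ≤ 1}

/-- For fixed `x` and `t` the defining expression is convex in the functionals and affine in the
weights; this is what the Legendre form provides. -/
theorem convex_weightedFamilies {p : ℝ} (hp : 0 ≤ p) :
    Convex ℝ (weightedFamilies 𝕜 X κ p) := by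
  rintro c ⟨hc1, hc2, hc3, hc4⟩ d ⟨hd1, hd2, hd3, hd4⟩ a b ha hb hab
  have hn : ∀ k x, ‖(a • c + b • d).2 k x‖ ≤ a * ‖c.2 k x‖ + b * ‖d.2 k x‖ := by
    intro k x
    refine (norm_add_le (a • c.2 k x) (b • d.2 k x)).trans (le_of_eq ?_)
    rw [norm_smul, norm_smul, Real.norm_of_nonneg ha, Real.norm_of_nonneg hb]
  refine ⟨fun k => ?_, ?_, fun k x => ?_, fun x hx t ht => ?_⟩
  · exact add_nonneg (mul_nonneg ha (hc1 k)) (mul_nonneg hb (hd1 k))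
  · have : ∑ k, (a • c + b • d).1 k = a * ∑ k, c.1 k + b * ∑ k, d.1 k := by
      simp [Finset.sum_add_distrib, Finset.mul_sum]
    rw [this]
    nlinarith
  · refine (hn k x).trans ?_
    have := mul_le_mul_of_nonneg_left (hc3 k x) ha
    have := mul_le_mul_of_nonneg_left (hd3 k x) hb
    have : a * ‖x‖ + b * ‖x‖ = ‖x‖ := by rw [← add_mul, hab, one_mul]
    linarith
  · have h1 := mul_le_mul_of_nonneg_left (hc4 x hx t ht) ha
    have h2 := mul_le_mul_of_nonneg_left (hd4 x hx t ht) hb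
    refine le_trans ?_ ((add_le_add h1 h2).trans (by linarith))
    rw [Finset.mul_sum, Finset.mul_sum, ← Finset.sum_add_distrib]
    refine Finset.sum_le_sum fun k _ => ?_
    have h3 := mul_le_mul_of_nonneg_left (hn k x) (mul_nonneg hp (Real.rpow_nonneg (ht k) (p - 1)))
    have h4 : (a • c + b • d).1 k = a * c.1 k + b * d.1 k := rfl
    rw [h4]
    linarith

/-- Every condition is closed for pointwise evaluation, and the set lies in a product of unit
intervals and dual balls, compact by Banach–Alaoglu. -/
theorem isCompact_weightedFamilies (p : ℝ) : IsCompact (weightedFamilies 𝕜 X κ p) := by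
  have hev : ∀ (k : κ) (x : X), Continuous fun c : (κ → ℝ) × (κ → WeakDual 𝕜 X) => c.2 k x :=
    fun k x => (WeakDual.eval_continuous x).comp ((continuous_apply k).comp continuous_snd)
  have hw : ∀ k : κ, Continuous fun c : (κ → ℝ) × (κ → WeakDual 𝕜 X) => c.1 k :=
    fun k => (continuous_apply k).comp continuous_fst
  have hcl : IsClosed (weightedFamilies 𝕜 X κ p) := by
    simp only [weightedFamilies, Set.ofPred_and, Set.ofPred_forall]
    refine (isClosed_iInter fun k => isClosed_le continuous_const (hw k)).inter
      ((isClosed_le (continuous_finsetSum _ fun k _ => hw k) continuous_const).inter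
      ((isClosed_iInter fun k => isClosed_iInter fun x =>
        isClosed_le (hev k x).norm continuous_const).inter
      (isClosed_iInter fun x => isClosed_iInter fun _ => isClosed_iInter fun t =>
        isClosed_iInter fun _ => isClosed_le (continuous_finsetSum _ fun k _ => ?_)
          continuous_const)))
    exact ((hev k x).norm.const_mul _).sub ((hw k).const_mul _)
  have hK : IsCompact ((Set.univ.pi fun _ : κ => Set.Icc (0 : ℝ) 1) ×ˢ
      (Set.univ.pi fun _ : κ => WeakDual.toStrongDual ⁻¹'
        Metric.closedBall (0 : StrongDual 𝕜 X) 1)) :=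
    (isCompact_univ_pi fun _ => isCompact_Icc).prod
      (isCompact_univ_pi fun _ => WeakDual.isCompact_closedBall 0 1)
  refine hK.of_isClosed_subset hcl ?_
  rintro c ⟨h1, h2, h3, -⟩
  refine ⟨fun k _ => ⟨h1 k, (Finset.single_le_sum (fun i _ => h1 i) (Finset.mem_univ k)).trans h2⟩,
    fun k _ => ?_⟩
  rw [Set.mem_preimage, mem_closedBall_zero_iff]
  exact ContinuousLinearMap.opNorm_le_bound _ zero_le_one fun x => by simpa using h3 k x

theorem exists_eq_rpow_smul_of_mem_weightedFamilies {p : ℝ} (hp : 1 ≤ p)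
    {c : (κ → ℝ) × (κ → WeakDual 𝕜 X)} (hc : c ∈ weightedFamilies 𝕜 X κ p) :
    ∃ ψ : κ → StrongDual 𝕜 X, (∀ x, ∑ k, ‖ψ k x‖ ^ p ≤ ‖x‖ ^ p) ∧
      ∀ k x, c.2 k x = ((c.1 k ^ ((p - 1) / p) : ℝ) : 𝕜) * ψ k x := by
  classical
  obtain ⟨h1, -, h3, h4⟩ := hc
  have hp0 : 0 < p := by linarith
  have hzero : ∀ k, 1 < p → c.1 k = 0 → ∀ x, ‖x‖ ≤ 1 → c.2 k x = 0 := by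
    intro k hp1 hk x hx
    by_contra hne
    have ha : 0 < ‖c.2 k x‖ := norm_pos_iff.2 hne
    have hb : 0 < 2 / (p * ‖c.2 k x‖) := by positivity
    -- With zero weight nothing penalises a large `t`; this one satisfies `p * t ^ (p - 1) * ‖c.2 k
    -- x‖ = 2` and so violates the bound `1`.
    have := h4 x hx (Pi.single k ((2 / (p * ‖c.2 k x‖)) ^ (1 / (p - 1)))) (fun j => by
      rcases eq_or_ne j k with rfl | hj
      · simpa using Real.rpow_nonneg hb.le _
      · simp [hj])
    rw [Finset.sum_eq_single k] at this
    · rw [Pi.single_eq_same, hk, ← Real.rpow_mul hb.le,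
        one_div_mul_cancel (by linarith : p - 1 ≠ 0), Real.rpow_one] at this
      have e : p * (2 / (p * ‖c.2 k x‖)) * ‖c.2 k x‖ = 2 := by field_simp
      rw [e] at this
      linarith
    · intro j _ hj
      rw [Pi.single_eq_of_ne hj, Real.zero_rpow (by linarith : p - 1 ≠ 0),
        Real.zero_rpow hp0.ne']
      ring
    · simp
  set ψ : κ → StrongDual 𝕜 X := fun k =>
    ((c.1 k ^ (-((p - 1) / p)) : ℝ) : 𝕜) • WeakDual.toStrongDual (c.2 k) with hψ
  have hψx : ∀ k x, ψ k x = ((c.1 k ^ (-((p - 1) / p)) : ℝ) : 𝕜) * c.2 k x := fun k x => rfl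
  have hψn : ∀ k x, ‖ψ k x‖ = c.1 k ^ (-((p - 1) / p)) * ‖c.2 k x‖ := fun k x => by
    rw [hψx, norm_mul, RCLike.norm_ofReal, abs_of_nonneg (Real.rpow_nonneg (h1 k) _)]
  have hball : ∀ x, ‖x‖ ≤ 1 → ∑ k, ‖ψ k x‖ ^ p ≤ 1 := by
    intro x hx
    -- The choice `t = ‖χ‖ / w` maximises the Legendre expression, with value `w ^ (1 - p) * ‖χ‖ ^
    -- p`. If `w = 0`, then `t = 0` by the convention for division, and `χ` vanishes unless `p = 1`.
    refine le_trans (Finset.sum_le_sum fun k _ => ?_)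
      (h4 x hx (fun k => ‖c.2 k x‖ / c.1 k) fun k => div_nonneg (norm_nonneg _) (h1 k))
    rw [hψn]
    rcases hp.eq_or_lt with rfl | hp1
    · simp
    · rcases (h1 k).eq_or_lt with hk | hk
      · rw [hzero k hp1 hk.symm x hx]
        simp [Real.zero_rpow hp0.ne']
      · rcases (norm_nonneg (c.2 k x)).eq_or_lt with ha | ha
        · simp [← ha, Real.zero_rpow hp0.ne']
        · refine le_of_eq ?_
          rw [Real.mul_rpow (Real.rpow_nonneg hk.le _) ha.le, ← Real.rpow_mul hk.le,
            Real.div_rpow ha.le hk.le, Real.div_rpow ha.le hk.le, Real.rpow_sub_one ha.ne',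
            Real.rpow_sub_one hk.ne', neg_mul, div_mul_cancel₀ _ hp0.ne', neg_sub,
            Real.rpow_sub hk, Real.rpow_one]
          field_simp
          ring
  refine ⟨ψ, fun x => ?_, fun k x => ?_⟩
  · rcases eq_or_ne x 0 with rfl | hx
    · simp [Real.zero_rpow hp0.ne']
    · have hx0 : 0 < ‖x‖ := norm_pos_iff.2 hx
      have := hball (((‖x‖⁻¹ : ℝ) : 𝕜) • x) (by
        rw [norm_smul, RCLike.norm_ofReal, abs_of_pos (inv_pos.2 hx0), inv_mul_cancel₀ hx0.ne'])
      have e : ∀ k, ‖ψ k (((‖x‖⁻¹ : ℝ) : 𝕜) • x)‖ ^ p = ‖ψ k x‖ ^ p / ‖x‖ ^ p := fun k => by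
        rw [map_smul, norm_smul, RCLike.norm_ofReal, abs_of_pos (inv_pos.2 hx0), inv_mul_eq_div,
          Real.div_rpow (norm_nonneg _) hx0.le]
      simp only [e] at this
      rwa [← Finset.sum_div, div_le_one (Real.rpow_pos_of_pos hx0 p)] at this
  · rw [hψx, ← mul_assoc, ← RCLike.ofReal_mul]
    rcases hp.eq_or_lt with rfl | hp1
    · simp
    · rcases (h1 k).eq_or_lt with hk | hk
      · have hz : c.2 k x = 0 := by
          have := hzero k hp1 hk.symm (((‖x‖⁻¹ : ℝ) : 𝕜) • x) (by
            rw [norm_smul, RCLike.norm_ofReal, abs_of_nonneg (inv_nonneg.2 (norm_nonneg _))]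
            exact inv_mul_le_one)
          rw [map_smul, smul_eq_zero] at this
          rcases this with h | h
          · have hx : x = 0 := by simpa using h
            rw [hx, map_zero]
          · exact h
        simp [hz]
      · rw [← Real.rpow_add hk, add_neg_cancel, Real.rpow_zero]
        simp

/-- Functionals `φ n` sharing the same norming index can be merged: Hölder inside a fibre loses
nothing when its weight is its share of `∑ t n ^ p`. This makes the number of functionals
independent of the length of `φ`. -/
theorem exists_mem_weightedFamilies_of_fibers [DecidableEq κ] {p : ℝ} (hp : 1 ≤ p)
    {φ : ι → StrongDual 𝕜 X} (hφ : ∀ x, ∑ n, ‖φ n x‖ ^ p ≤ ‖x‖ ^ p) (k : ι → κ) {t : ι → ℝ}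
    (ht : ∀ n, 0 ≤ t n) (ht1 : ∑ n, t n ^ p ≤ 1) {s : ι → 𝕜} (hs : ∀ n, ‖s n‖ = 1) :
    ∃ c ∈ weightedFamilies 𝕜 X κ p, ∀ j x,
      c.2 j x = ∑ n with k n = j, (((t n ^ (p - 1) : ℝ) : 𝕜) * s n) * φ n x := by
  have hp0 : 0 < p := by linarith
  set χ : κ → StrongDual 𝕜 X := fun j =>
    ∑ n with k n = j, (((t n ^ (p - 1) : ℝ) : 𝕜) * s n) • φ n with hχ
  have hχx : ∀ j x, χ j x = ∑ n with k n = j, (((t n ^ (p - 1) : ℝ) : 𝕜) * s n) * φ n x := by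
    intro j x
    simp [hχ]
  have hχn : ∀ j x, ‖χ j x‖ ≤ ∑ n with k n = j, t n ^ (p - 1) * ‖φ n x‖ := by
    intro j x
    rw [hχx]
    refine (norm_sum_le _ _).trans (Finset.sum_le_sum fun n _ => le_of_eq ?_)
    rw [norm_mul, norm_mul, hs, mul_one, RCLike.norm_ofReal,
      abs_of_nonneg (Real.rpow_nonneg (ht n) _)]
  refine ⟨(fun j => ∑ n with k n = j, t n ^ p, fun j => StrongDual.toWeakDual (χ j)),
    ⟨fun j => Finset.sum_nonneg fun n _ => Real.rpow_nonneg (ht n) p, ?_, fun j x => ?_,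
      fun x hx r hr => ?_⟩, hχx⟩
  · rw [Finset.sum_fiberwise]
    exact ht1
  · refine (hχn j x).trans ((Finset.sum_le_sum_of_subset_of_nonneg (Finset.filter_subset _ _)
      fun n _ _ => mul_nonneg (Real.rpow_nonneg (ht n) _) (norm_nonneg _)).trans
      ((Real.sum_rpow_sub_one_mul_le hp ht (fun n => norm_nonneg (φ n x)) ht1).trans ?_))
    have := Real.rpow_le_rpow (Finset.sum_nonneg fun n _ => Real.rpow_nonneg (norm_nonneg _) p)
      (hφ x) (one_div_pos.2 hp0).le
    rwa [← Real.rpow_mul (norm_nonneg _), mul_one_div_cancel hp0.ne', Real.rpow_one] at this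
  -- Young's inequality at the point `r (k n) * t n`; summed over a fibre it yields the Legendre
  -- form.
  · have key : ∀ n, p * r (k n) ^ (p - 1) * (t n ^ (p - 1) * ‖φ n x‖)
        - (p - 1) * r (k n) ^ p * t n ^ p ≤ ‖φ n x‖ ^ p := by
      intro n
      have := Real.mul_rpow_sub_one_mul_le hp (mul_nonneg (hr (k n)) (ht n)) (norm_nonneg (φ n x))
      rw [Real.mul_rpow (hr _) (ht n), Real.mul_rpow (hr _) (ht n)] at this
      linarith
    calc ∑ j, (p * r j ^ (p - 1) * ‖χ j x‖ - (p - 1) * r j ^ p * ∑ n with k n = j, t n ^ p)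
        ≤ ∑ j, ∑ n with k n = j, (p * r (k n) ^ (p - 1) * (t n ^ (p - 1) * ‖φ n x‖)
            - (p - 1) * r (k n) ^ p * t n ^ p) := by
          refine Finset.sum_le_sum fun j _ => ?_
          have e : ∀ n ∈ Finset.univ.filter (fun n => k n = j),
              p * r (k n) ^ (p - 1) * (t n ^ (p - 1) * ‖φ n x‖) - (p - 1) * r (k n) ^ p * t n ^ p
              = p * r j ^ (p - 1) * (t n ^ (p - 1) * ‖φ n x‖) - (p - 1) * r j ^ p * t n ^ p := by
            intro n hn
            rw [(Finset.mem_filter.1 hn).2]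
          rw [Finset.sum_congr rfl e, Finset.sum_sub_distrib, ← Finset.mul_sum, ← Finset.mul_sum]
          have := mul_le_mul_of_nonneg_left (hχn j x)
            (mul_nonneg hp0.le (Real.rpow_nonneg (hr j) (p - 1)))
          linarith
      _ = ∑ n, (p * r (k n) ^ (p - 1) * (t n ^ (p - 1) * ‖φ n x‖)
            - (p - 1) * r (k n) ^ p * t n ^ p) := Finset.sum_fiberwise _ _ _
      _ ≤ ∑ n, ‖φ n x‖ ^ p := Finset.sum_le_sum fun n _ => key n
      _ ≤ ‖x‖ ^ p := hφ x
      _ ≤ 1 := Real.rpow_le_one (norm_nonneg _) hx hp0.le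

end

/-! ### Representation of functionals on `X ^ ι` and passage to the bidual -/

section

variable {𝕜 X κ ι : Type*} [RCLike 𝕜] [NormedAddCommGroup X] [NormedSpace 𝕜 X] [Fintype κ]
  [Fintype ι]

/-- The functional on `X ^ ι` obtained from a family `χ` of functionals on `X` and a matrix `e`. -/
noncomputable def matrixFunctional (e : κ → ι → 𝕜) (χ : κ → WeakDual 𝕜 X) : (ι → X) →ₗ[𝕜] 𝕜 where
  toFun z := ∑ k, ∑ i, e k i * χ k (z i)
  map_add' z z' := by simp [mul_add, Finset.sum_add_distrib]
  map_smul' a z := by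
    simp only [Pi.smul_apply, map_smul, smul_eq_mul, RingHom.id_apply, Finset.mul_sum]
    exact Finset.sum_congr rfl fun k _ => Finset.sum_congr rfl fun i _ => by ring

theorem matrixFunctional_apply (e : κ → ι → 𝕜) (χ : κ → WeakDual 𝕜 X) (z : ι → X) :
    matrixFunctional e χ z = ∑ k, ∑ i, e k i * χ k (z i) := rfl

/-- The image of a compact convex set under a continuous linear map into the algebraic dual of `X ^
ι`, with pointwise topology, is compact and convex. Hence domination by its support function gives
exact membership. -/
theorem mem_image_matrixFunctional {p : ℝ} (hp : 1 ≤ p) (e : κ → ι → 𝕜) (f : (ι → X) →ₗ[𝕜] 𝕜)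
    (h : ∀ (z : ι → X) (r : ℝ), (∀ c ∈ weightedFamilies 𝕜 X κ p,
      RCLike.re (matrixFunctional e c.2 z) ≤ r) → RCLike.re (f z) ≤ r) :
    ∃ c ∈ weightedFamilies 𝕜 X κ p, matrixFunctional e c.2 = f := by
  let Φ : (κ → ℝ) × (κ → WeakDual 𝕜 X) →
      WeakBilin (LinearMap.id : ((ι → X) →ₗ[𝕜] 𝕜) →ₗ[𝕜] (ι → X) →ₗ[𝕜] 𝕜) :=
    fun c => matrixFunctional e c.2
  have hlin : IsLinearMap ℝ Φ := by
    constructor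
    · intro c d
      refine LinearMap.ext fun z => ?_
      change ∑ k, ∑ i, e k i * (c.2 k (z i) + d.2 k (z i)) =
        ∑ k, ∑ i, e k i * c.2 k (z i) + ∑ k, ∑ i, e k i * d.2 k (z i)
      simp [mul_add, Finset.sum_add_distrib]
    · intro a c
      refine LinearMap.ext fun z => ?_
      change ∑ k, ∑ i, e k i * (a • c.2 k (z i)) = a • ∑ k, ∑ i, e k i * c.2 k (z i)
      simp [Finset.smul_sum]
  have hcont : Continuous Φ := by
    refine WeakBilin.continuous_of_continuous_eval _ fun z => ?_
    change Continuous fun c : (κ → ℝ) × (κ → WeakDual 𝕜 X) => ∑ k, ∑ i, e k i * c.2 k (z i)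
    exact continuous_finsetSum _ fun k _ => continuous_finsetSum _ fun i _ =>
      continuous_const.mul ((WeakDual.eval_continuous (z i)).comp
        ((continuous_apply k).comp continuous_snd))
  have := mem_of_re_le_of_isCompact ((convex_weightedFamilies (by linarith)).is_linear_image hlin)
    ((isCompact_weightedFamilies p).image hcont) f fun z r hr =>
      h z r fun c hc => hr _ ⟨c, hc, rfl⟩
  exact this

theorem zero_mem_weightedFamilies {p : ℝ} :
    (0 : (κ → ℝ) × (κ → WeakDual 𝕜 X)) ∈ weightedFamilies 𝕜 X κ p := by
  have h0 : ∀ (k : κ) (x : X), ‖((0 : (κ → ℝ) × (κ → WeakDual 𝕜 X)).2 k) x‖ = 0 :=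
    fun k x => norm_zero
  refine ⟨fun k => le_rfl, by simp, fun k x => ?_, fun x _ t _ => ?_⟩
  · rw [h0]
    exact norm_nonneg _
  · simp only [h0]
    simp

/-- The support function controls the mid norm: for each `n` take an almost norming `e (k n)` for
`(φ n (z i))_i`, correct its phase by `s n`, and combine over `n` with the dual vector `t ^ (p -
1)`. -/
theorem rpow_sum_le_of_re_matrixFunctional_le {p θ : ℝ} (hp : 1 ≤ p) (hθ : 0 < θ)
    {e : κ → ι → 𝕜} (he : ∀ v : ι → 𝕜, ∃ k, θ * (∑ i, ‖v i‖ ^ p) ^ (1 / p) ≤ ‖∑ i, e k i * v i‖)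
    {z : ι → X} {r : ℝ}
    (hr : ∀ c ∈ weightedFamilies 𝕜 X κ p, RCLike.re (matrixFunctional e c.2 z) ≤ r)
    {ν : Type*} [Fintype ν] {φ : ν → StrongDual 𝕜 X} (hφ : ∀ x, ∑ n, ‖φ n x‖ ^ p ≤ ‖x‖ ^ p) :
    ∑ n, ∑ i, ‖φ n (z i)‖ ^ p ≤ (r / θ) ^ p := by
  classical
  have hp0 : 0 < p := by linarith
  have hS : ∀ u : ι → 𝕜, 0 ≤ ∑ i, ‖u i‖ ^ p := fun u =>
    Finset.sum_nonneg fun i _ => Real.rpow_nonneg (norm_nonneg _) p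
  set a : ν → ℝ := fun n => (∑ i, ‖φ n (z i)‖ ^ p) ^ (1 / p) with ha
  have ha0 : ∀ n, 0 ≤ a n := fun n => Real.rpow_nonneg (hS _) _
  have hap : ∀ n, a n ^ p = ∑ i, ‖φ n (z i)‖ ^ p := fun n => by
    rw [ha, ← Real.rpow_mul (hS _), one_div_mul_cancel hp0.ne', Real.rpow_one]
  obtain ⟨t, ht, ht1, hta⟩ := Real.exists_sum_mul_rpow_sub_one_eq hp ha0
  choose k hk using fun n => he fun i => φ n (z i)
  choose s hs1 hs using fun n => RCLike.exists_norm_one_mul_eq (∑ i, e (k n) i * φ n (z i))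
  obtain ⟨c, hc, hcx⟩ := exists_mem_weightedFamilies_of_fibers hp hφ k ht ht1 hs1
  have h1 : matrixFunctional e c.2 z =
      ((∑ n, t n ^ (p - 1) * ‖∑ i, e (k n) i * φ n (z i)‖ : ℝ) : 𝕜) := by
    rw [matrixFunctional_apply]
    calc ∑ j, ∑ i, e j i * c.2 j (z i)
        = ∑ j, ∑ n with k n = j, ((t n ^ (p - 1) : ℝ) : 𝕜) *
            (s n * ∑ i, e (k n) i * φ n (z i)) := by
          refine Finset.sum_congr rfl fun j _ => ?_
          simp only [hcx, Finset.mul_sum]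
          rw [Finset.sum_comm]
          refine Finset.sum_congr rfl fun n hn => Finset.sum_congr rfl fun i _ => ?_
          rw [(Finset.mem_filter.1 hn).2]
          ring
      _ = ∑ n, ((t n ^ (p - 1) : ℝ) : 𝕜) * (s n * ∑ i, e (k n) i * φ n (z i)) :=
          Finset.sum_fiberwise _ _ _
      _ = _ := by
          push_cast
          exact Finset.sum_congr rfl fun n _ => by rw [hs]
  have h2 := hr c hc
  rw [h1, RCLike.ofReal_re] at h2
  have h3 : θ * (∑ n, a n ^ p) ^ (1 / p) ≤ r := by
    rw [← hta, Finset.mul_sum]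
    refine (Finset.sum_le_sum fun n _ => ?_).trans h2
    have := mul_le_mul_of_nonneg_left (hk n) (Real.rpow_nonneg (ht n) (p - 1))
    linarith
  have hA : 0 ≤ ∑ n, a n ^ p := Finset.sum_nonneg fun n _ => Real.rpow_nonneg (ha0 n) p
  have h4 : (∑ n, a n ^ p) ^ (1 / p) ≤ r / θ := by
    rw [le_div_iff₀ hθ]; linarith
  have h5 := Real.rpow_le_rpow (Real.rpow_nonneg hA _) h4 hp0.le
  rw [← Real.rpow_mul hA, one_div_mul_cancel hp0.ne', Real.rpow_one] at h5
  simpa only [hap] using h5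

/-- If a functional on `X ^ ι` is bounded by `C` times the mid `p`-summing norm, then its bitranspose
is bounded by `C` times the mid `p`-summing norm of the bidual. -/
theorem norm_sum_bidual_apply_le {p C : ℝ} (hp : 1 ≤ p) (hC : 0 < C) {f : ι → StrongDual 𝕜 X}
    (hf : ∀ (z : ι → X) (r : ℝ), 0 < r →
      (∀ (N : ℕ) (φ : Fin N → StrongDual 𝕜 X), (∀ x, ∑ n, ‖φ n x‖ ^ p ≤ ‖x‖ ^ p) →
        ∑ n, ∑ i, ‖φ n (z i)‖ ^ p ≤ r ^ p) → ‖∑ i, f i (z i)‖ ≤ C * r)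
    {ξ : ι → StrongDual 𝕜 (StrongDual 𝕜 X)}
    (hξ : ∀ (N : ℕ) (ψ : Fin N → StrongDual 𝕜 X), (∀ x, ∑ n, ‖ψ n x‖ ^ p ≤ ‖x‖ ^ p) →
      ∑ n, ∑ i, ‖ξ i (ψ n)‖ ^ p ≤ 1) :
    ‖∑ i, ξ i (f i)‖ ≤ C := by
  classical
  have hp0 : 0 < p := by linarith
  suffices H : ∀ θ : ℝ, 0 < θ → θ < 1 → ‖∑ i, ξ i (f i)‖ ≤ C / θ by
    by_contra! hlt
    obtain ⟨B, hB1, hB2⟩ := exists_between hlt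
    have hB0 : 0 < B := hC.trans hB1
    have := H (C / B) (div_pos hC hB0) ((div_lt_one hB0).2 hB1)
    rw [div_div_cancel₀ hC.ne'] at this
    linarith
  intro θ hθ hθ1
  obtain ⟨N, e, he1, he2⟩ := RCLike.exists_finite_norming (𝕜 := 𝕜) (ι := ι) hp hθ1
  set F : (ι → X) →ₗ[𝕜] 𝕜 := ((θ / C : ℝ) : 𝕜) • ∑ i, (f i).toLinearMap ∘ₗ LinearMap.proj i
    with hF
  have hFz : ∀ z, F z = ((θ / C : ℝ) : 𝕜) * ∑ i, f i (z i) := fun z => by simp [hF]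
  obtain ⟨c, hc, hcF⟩ := mem_image_matrixFunctional hp e F fun z r hr => by
    have hr0 : 0 ≤ r := by
      refine le_trans (le_of_eq ?_) (hr 0 zero_mem_weightedFamilies)
      have : matrixFunctional e (0 : (Fin N → ℝ) × (Fin N → WeakDual 𝕜 X)).2 z = 0 := by
        rw [matrixFunctional_apply]
        exact Finset.sum_eq_zero fun k _ => Finset.sum_eq_zero fun i _ => mul_zero _
      rw [this, map_zero]
    -- `hf` requires a strictly positive radius, while `r` may be `0`.
    refine le_of_forall_pos_le_add fun ε hε => ?_
    have h1 := hf z ((r + ε) / θ) (div_pos (by linarith) hθ) fun M φ hφ =>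
      (rpow_sum_le_of_re_matrixFunctional_le hp hθ he2 hr hφ).trans
        (Real.rpow_le_rpow (div_nonneg hr0 hθ.le)
          (div_le_div_of_nonneg_right (by linarith) hθ.le) hp0.le)
    refine (RCLike.re_le_norm _).trans ?_
    rw [hFz, norm_mul, RCLike.norm_ofReal, abs_of_pos (div_pos hθ hC)]
    refine (mul_le_mul_of_nonneg_left h1 (div_pos hθ hC).le).trans (le_of_eq ?_)
    field_simp
  obtain ⟨ψ, hψ, hcψ⟩ := exists_eq_rpow_smul_of_mem_weightedFamilies hp hc
  -- With this root the coefficients become `w k ^ (p - 1)` and `∑ w k ^ p ≤ 1`, the shape used in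
  -- Hölder's inequality.
  set w : Fin N → ℝ := fun k => c.1 k ^ (1 / p) with hw
  have hw0 : ∀ k, 0 ≤ w k := fun k => Real.rpow_nonneg (hc.1 k) _
  have hwp : ∀ k, w k ^ p = c.1 k := fun k => by
    rw [hw, ← Real.rpow_mul (hc.1 k), one_div_mul_cancel hp0.ne', Real.rpow_one]
  have hwp1 : ∀ k, c.1 k ^ ((p - 1) / p) = w k ^ (p - 1) := fun k => by
    rw [hw, ← Real.rpow_mul (hc.1 k), one_div_mul_eq_div]
  -- Evaluation on tuples supported at one index separates the components of `f`.
  have hfi : ∀ i, f i = ((C / θ : ℝ) : 𝕜) • ∑ k, (e k i * ((w k ^ (p - 1) : ℝ) : 𝕜)) • ψ k := by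
    intro i
    ext x
    have h1 := LinearMap.congr_fun hcF (Pi.single i x)
    rw [hFz, matrixFunctional_apply] at h1
    have h2 : ∀ g : ι → X → 𝕜, (∀ j, g j 0 = 0) →
        ∑ j, g j ((Pi.single i x : ι → X) j) = g i x := by
      intro g hg
      rw [Finset.sum_eq_single i]
      · rw [Pi.single_eq_same]
      · intro j _ hj
        rw [Pi.single_eq_of_ne hj, hg]
      · simp
    rw [h2 (fun j y => f j y) fun j => map_zero _] at h1
    have h3 : ∑ k, e k i * (((w k ^ (p - 1) : ℝ) : 𝕜) * ψ k x) = ((θ / C : ℝ) : 𝕜) * f i x := by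
      rw [← h1]
      refine Finset.sum_congr rfl fun k _ => ?_
      rw [h2 (fun j y => e k j * c.2 k y) fun j => by simp, hcψ, hwp1]
    have h4 : ((C / θ : ℝ) : 𝕜) * ((θ / C : ℝ) : 𝕜) = 1 := by
      rw [← RCLike.ofReal_mul, div_mul_div_cancel₀ hθ.ne', div_self hC.ne', RCLike.ofReal_one]
    have h5 : (((C / θ : ℝ) : 𝕜) • ∑ k, (e k i * ((w k ^ (p - 1) : ℝ) : 𝕜)) • ψ k) x =
        ((C / θ : ℝ) : 𝕜) * ∑ k, e k i * (((w k ^ (p - 1) : ℝ) : 𝕜) * ψ k x) := by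
      simp [mul_assoc]
    rw [h5, h3, ← mul_assoc, h4, one_mul]
  have hsum : ∑ i, ξ i (f i) =
      ((C / θ : ℝ) : 𝕜) * ∑ k, ((w k ^ (p - 1) : ℝ) : 𝕜) * ∑ i, e k i * ξ i (ψ k) := by
    have : ∀ i, ξ i (f i) =
        ((C / θ : ℝ) : 𝕜) * ∑ k, (e k i * ((w k ^ (p - 1) : ℝ) : 𝕜)) * ξ i (ψ k) := fun i => by
      rw [hfi i, map_smul, map_sum]
      simp
    simp only [this, ← Finset.mul_sum]
    rw [Finset.sum_comm]
    congr 1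
    refine Finset.sum_congr rfl fun k _ => ?_
    rw [Finset.mul_sum]
    exact Finset.sum_congr rfl fun i _ => by ring
  have hS : ∀ k, 0 ≤ ∑ i, ‖ξ i (ψ k)‖ ^ p := fun k =>
    Finset.sum_nonneg fun i _ => Real.rpow_nonneg (norm_nonneg _) p
  rw [hsum, norm_mul, RCLike.norm_ofReal, abs_of_pos (div_pos hC hθ)]
  refine mul_le_of_le_one_right (div_pos hC hθ).le ((norm_sum_le _ _).trans ?_)
  calc ∑ k, ‖((w k ^ (p - 1) : ℝ) : 𝕜) * ∑ i, e k i * ξ i (ψ k)‖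
      ≤ ∑ k, w k ^ (p - 1) * (∑ i, ‖ξ i (ψ k)‖ ^ p) ^ (1 / p) := by
        refine Finset.sum_le_sum fun k _ => ?_
        rw [norm_mul, RCLike.norm_ofReal, abs_of_nonneg (Real.rpow_nonneg (hw0 k) _)]
        exact mul_le_mul_of_nonneg_left (he1 k _) (Real.rpow_nonneg (hw0 k) _)
    _ ≤ (∑ k, ((∑ i, ‖ξ i (ψ k)‖ ^ p) ^ (1 / p)) ^ p) ^ (1 / p) :=
        Real.sum_rpow_sub_one_mul_le hp hw0 (fun k => Real.rpow_nonneg (hS k) _)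
          (by simpa only [hwp] using hc.2.1)
    _ = (∑ k, ∑ i, ‖ξ i (ψ k)‖ ^ p) ^ (1 / p) := by
        congr 1
        refine Finset.sum_congr rfl fun k _ => ?_
        rw [← Real.rpow_mul (hS k), one_div_mul_cancel hp0.ne', Real.rpow_one]
    _ ≤ 1 := Real.rpow_le_one (Finset.sum_nonneg fun k _ => hS k) (hξ N ψ hψ) (by positivity)

end

/-! ### Generalities on sequence spaces; strong and weak norms -/

theorem ENNReal.rpow_one_div_le_iff_le_rpow {x y : ℝ≥0∞} {z : ℝ} (hz : 0 < z) :
    x ^ (1 / z) ≤ y ↔ x ≤ y ^ z := by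
  rw [one_div, ENNReal.rpow_inv_le_iff hz]

theorem ENNReal.mul_rpow_mul_rpow_one_div {z : ℝ} (hz : 0 < z) (c x : ℝ≥0∞) :
    (c ^ z * x) ^ (1 / z) = c * x ^ (1 / z) := by
  rw [ENNReal.mul_rpow_of_nonneg _ _ (one_div_pos.2 hz).le, ← ENNReal.rpow_mul,
    mul_one_div_cancel hz.ne', ENNReal.rpow_one]

theorem enorm_rpow_eq_ofReal {E : Type*} [SeminormedAddGroup E] (x : E) {z : ℝ} (hz : 0 ≤ z) :
    ‖x‖ₑ ^ z = ENNReal.ofReal (‖x‖ ^ z) := by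
  rw [← ofReal_norm, ENNReal.ofReal_rpow_of_nonneg (norm_nonneg x) hz]

theorem sum_enorm_rpow_eq_ofReal {E ι : Type*} [SeminormedAddGroup E] (s : Finset ι) (x : ι → E)
    {z : ℝ} (hz : 0 ≤ z) : ∑ i ∈ s, ‖x i‖ₑ ^ z = ENNReal.ofReal (∑ i ∈ s, ‖x i‖ ^ z) := by
  rw [ENNReal.ofReal_sum_of_nonneg fun i _ => Real.rpow_nonneg (norm_nonneg _) z]
  exact Finset.sum_congr rfl fun i _ => enorm_rpow_eq_ofReal (x i) hz

namespace SeqSpace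

section General

variable {𝕜 X Y : Type*} [RCLike 𝕜] [NormedAddCommGroup X] [NormedSpace 𝕜 X]
  [NormedAddCommGroup Y] [NormedSpace 𝕜 Y]

variable (𝕜) in
/-- The norm of a sequence space is absolutely homogeneous. -/
def IsHomogeneous (A : SeqSpace X) : Prop :=
  ∀ (c : 𝕜) (x : ℕ → X), A.nrm (fun j => c • x j) = ‖c‖ₑ * A.nrm x

variable (𝕜) in
/-- The members of a sequence space form a vector space normed by its norm. -/
structure IsNormed (A : SeqSpace X) : Prop where
  zero_mem : (fun _ => 0) ∈ A.mem
  sub_mem : ∀ x ∈ A.mem, ∀ y ∈ A.mem, (fun j => x j - y j) ∈ A.mem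
  smul_mem : ∀ (c : 𝕜), ∀ x ∈ A.mem, (fun j => c • x j) ∈ A.mem
  homogeneous : A.IsHomogeneous 𝕜

theorem nrm_map_le {A : SeqSpace X} {B : SeqSpace Y} (hA : A.IsNormed 𝕜) (hB : B.IsHomogeneous 𝕜)
    (T : X →L[𝕜] Y) {x : ℕ → X} (hx : x ∈ A.mem) {r : ℝ} (hr : 0 < r)
    (hxr : A.nrm x ≤ ENNReal.ofReal r) :
    B.nrm (fun j => T (x j)) ≤ ENNReal.ofReal r * A.opNorm B T := by
  have hr0 : ENNReal.ofReal r ≠ 0 := (ENNReal.ofReal_pos.2 hr).ne'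
  have hc : ‖((r⁻¹ : ℝ) : 𝕜)‖ₑ = (ENNReal.ofReal r)⁻¹ := by
    rw [← ofReal_norm, RCLike.norm_ofReal, abs_of_pos (inv_pos.2 hr),
      ENNReal.ofReal_inv_of_pos hr]
  have hmem : (fun j => ((r⁻¹ : ℝ) : 𝕜) • x j) ∈ A.unitBall := by
    refine ⟨hA.smul_mem _ x hx, ?_⟩
    rw [hA.homogeneous, hc]
    exact (mul_le_mul_right hxr _).trans (ENNReal.inv_mul_le_one _)
  have h : B.nrm (fun j => T (((r⁻¹ : ℝ) : 𝕜) • x j)) ≤ A.opNorm B T :=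
    le_iSup₂ (f := fun (x : ℕ → X) (_ : x ∈ A.unitBall) => B.nrm fun j => T (x j)) _ hmem
  simp only [map_smul] at h
  rw [hB, hc] at h
  calc B.nrm (fun j => T (x j))
      = ENNReal.ofReal r * ((ENNReal.ofReal r)⁻¹ * B.nrm fun j => T (x j)) := by
        rw [← mul_assoc, ENNReal.mul_inv_cancel hr0 ENNReal.ofReal_ne_top, one_mul]
    _ ≤ _ := mul_le_mul_right h _

/-- Continuity at the zero sequence already bounds the operator norm by scaling. Conversely, since
finite norm implies membership in `B`, a finite operator norm also gives well-definedness. -/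
theorem inducesContinuous_iff {A : SeqSpace X} {B : SeqSpace Y} (hA : A.IsNormed 𝕜)
    (hAfin : ∀ x ∈ A.mem, A.nrm x < ∞) (hB : B.IsHomogeneous 𝕜)
    (hBmem : ∀ y, B.nrm y < ∞ → y ∈ B.mem) (T : X →L[𝕜] Y) :
    A.InducesContinuous B T ↔ A.opNorm B T < ∞ := by
  constructor
  · rintro ⟨-, h⟩
    obtain ⟨δ, hδ, hT⟩ := h _ hA.zero_mem 1 one_pos
    obtain ⟨c, hc0, hc⟩ := ENNReal.lt_iff_exists_nnreal_btwn.1 hδ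
    have hcn : ‖((c : ℝ) : 𝕜)‖ₑ = c := by
      rw [← ofReal_norm, RCLike.norm_ofReal, NNReal.abs_eq, ENNReal.ofReal_coe_nnreal]
    refine lt_of_le_of_lt (iSup₂_le (a := (c : ℝ≥0∞)⁻¹) fun x hx => ?_)
      (ENNReal.inv_lt_top.2 hc0)
    have h1 : A.nrm (fun j => ((c : ℝ) : 𝕜) • x j) < δ := by
      rw [hA.homogeneous, hcn]
      exact (mul_le_of_le_one_right' hx.2).trans_lt hc
    have h2 := hT (fun j => ((c : ℝ) : 𝕜) • x j) (hA.smul_mem _ x hx.1) (by simpa using h1)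
    simp only [map_zero, sub_zero, map_smul] at h2
    rw [hB, hcn] at h2
    rw [ENNReal.le_inv_iff_mul_le, mul_comm]
    exact h2.le
  · intro h
    refine ⟨fun x hx => hBmem _ ?_, fun x hx ε hε => ?_⟩
    · have hr : A.nrm x ≤ ENNReal.ofReal ((A.nrm x).toReal + 1) :=
        (ENNReal.ofReal_toReal (hAfin x hx).ne).symm.le.trans
          (ENNReal.ofReal_le_ofReal (by linarith))
      exact (nrm_map_le hA hB T hx (by positivity) hr).trans_lt
        (ENNReal.mul_lt_top ENNReal.ofReal_lt_top h)
    · obtain ⟨r, hr, hrε⟩ : ∃ r : ℝ, 0 < r ∧ ENNReal.ofReal r * A.opNorm B T < ε := by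
        obtain ⟨r, hr, hrε⟩ := ENNReal.exists_nnreal_pos_mul_lt h.ne hε.ne'
        exact ⟨r, hr, by rwa [ENNReal.ofReal_coe_nnreal]⟩
      refine ⟨ENNReal.ofReal r, ENNReal.ofReal_pos.2 hr, fun y hy hlt => ?_⟩
      have := nrm_map_le hA hB T (hA.sub_mem y hy x hx) hr hlt.le
      simp only [map_sub] at this
      exact this.trans_lt hrε

end General

section Strong

variable {X : Type*} [NormedAddCommGroup X]

theorem nrm_strong_coe (p : ℝ≥0) (x : ℕ → X) :
    (strong (p : ℝ≥0∞) X).nrm x = (∑' j, ‖x j‖ₑ ^ (p : ℝ)) ^ (1 / (p : ℝ)) := by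
  simp [strong]

theorem mem_strong_iff {q : ℝ≥0∞} (hq : q ≠ 0) {x : ℕ → X} :
    x ∈ (strong q X).mem ↔ (strong q X).nrm x < ∞ := by
  change Memℓp x q ↔ (if q = ∞ then ⨆ j, ‖x j‖ₑ else _) < ∞
  split_ifs with h
  · subst h
    rw [memℓp_infty_iff]
    constructor
    · rintro ⟨C, hC⟩
      refine lt_of_le_of_lt (iSup_le (a := ENNReal.ofReal C) fun j => ?_) ENNReal.ofReal_lt_top
      rw [← ofReal_norm]
      exact ENNReal.ofReal_le_ofReal (hC ⟨j, rfl⟩)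
    · intro h
      refine ⟨(⨆ j, ‖x j‖ₑ).toReal, ?_⟩
      rintro _ ⟨j, rfl⟩
      have := ENNReal.toReal_mono h.ne (le_iSup (fun j => ‖x j‖ₑ) j)
      simpa using this
  · have hq0 := ENNReal.toReal_pos hq h
    rw [memℓp_gen_iff hq0, ENNReal.rpow_lt_top_iff_of_pos (one_div_pos.2 hq0)]
    simp only [enorm_rpow_eq_ofReal _ hq0.le]
    constructor
    · intro hs
      rw [← ENNReal.ofReal_tsum_of_nonneg (fun j => Real.rpow_nonneg (norm_nonneg _) _) hs]
      exact ENNReal.ofReal_lt_top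
    · intro hs
      have := ENNReal.summable_toReal hs.ne
      simpa only [ENNReal.toReal_ofReal (Real.rpow_nonneg (norm_nonneg _) _)] using this

theorem isHomogeneous_strong (𝕜 : Type*) [RCLike 𝕜] [NormedSpace 𝕜 X] {q : ℝ≥0∞} (hq : q ≠ 0) :
    (strong q X).IsHomogeneous 𝕜 := by
  intro c x
  change (if q = ∞ then ⨆ j, ‖c • x j‖ₑ else (∑' j, ‖c • x j‖ₑ ^ q.toReal) ^ (1 / q.toReal)) =
    ‖c‖ₑ * if q = ∞ then ⨆ j, ‖x j‖ₑ else (∑' j, ‖x j‖ₑ ^ q.toReal) ^ (1 / q.toReal)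
  simp only [enorm_smul]
  split_ifs with h
  · rw [ENNReal.mul_iSup]
  · have hq0 := ENNReal.toReal_pos hq h
    simp only [ENNReal.mul_rpow_of_nonneg _ _ hq0.le]
    rw [ENNReal.tsum_mul_left, ENNReal.mul_rpow_mul_rpow_one_div hq0]

theorem isNormed_strong (𝕜 : Type*) [RCLike 𝕜] [NormedSpace 𝕜 X] {q : ℝ≥0∞} (hq : q ≠ 0) :
    (strong q X).IsNormed 𝕜 where
  zero_mem := zero_memℓp
  sub_mem _ hx _ hy := Memℓp.sub hx hy
  smul_mem c _ hx := Memℓp.const_smul hx c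
  homogeneous := isHomogeneous_strong 𝕜 hq

end Strong

section Weak

variable {𝕜 X : Type*} [RCLike 𝕜] [NormedAddCommGroup X] [NormedSpace 𝕜 X]

theorem tsum_enorm_apply_rpow_le {p : ℝ≥0} (hp : 0 < p) {x : ℕ → X}
    (hx : (weak 𝕜 X p).nrm x ≤ 1) (φ : StrongDual 𝕜 X) :
    ∑' j, ‖φ (x j)‖ₑ ^ (p : ℝ) ≤ ‖φ‖ₑ ^ (p : ℝ) := by
  have hp0 : (0 : ℝ) < p := hp
  rcases eq_or_ne φ 0 with rfl | hφ
  · simp [hp0]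
  have hφ0 : 0 < ‖φ‖ := norm_pos_iff.2 hφ
  have h1 : (∑' j, ‖(((‖φ‖⁻¹ : ℝ) : 𝕜) • φ) (x j)‖ₑ ^ (p : ℝ)) ^ (1 / (p : ℝ)) ≤ 1 := by
    refine le_trans ?_ hx
    refine le_iSup₂ (f := fun (φ : StrongDual 𝕜 X) (_ : ‖φ‖ ≤ 1) =>
      (∑' j, ‖φ (x j)‖ₑ ^ (p : ℝ)) ^ (1 / (p : ℝ))) (((‖φ‖⁻¹ : ℝ) : 𝕜) • φ) ?_
    rw [norm_smul, RCLike.norm_ofReal, abs_of_pos (inv_pos.2 hφ0), inv_mul_cancel₀ hφ0.ne']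
  have hc : ‖((‖φ‖⁻¹ : ℝ) : 𝕜)‖ₑ = (‖φ‖ₑ)⁻¹ := by
    rw [← ofReal_norm, RCLike.norm_ofReal, abs_of_pos (inv_pos.2 hφ0),
      ENNReal.ofReal_inv_of_pos hφ0, ofReal_norm]
  have hφe : ‖φ‖ₑ ≠ 0 := by
    rw [← ofReal_norm]
    exact (ENNReal.ofReal_pos.2 hφ0).ne'
  simp only [smul_apply, enorm_smul, hc,
    ENNReal.mul_rpow_of_nonneg _ _ hp0.le] at h1
  rw [ENNReal.tsum_mul_left, ENNReal.mul_rpow_mul_rpow_one_div hp0,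
    ENNReal.inv_mul_le_iff hφe enorm_ne_top, mul_one, ENNReal.rpow_one_div_le_iff_le_rpow hp0] at h1
  exact h1

/-- The weak norm on `X*` tests against `X**`, whereas the finite families are controlled only on
`X`; `StrongDual.sum_norm_bidual_rpow_le` bridges the two. -/
theorem mem_weak_unitBall_of_fin {p : ℝ≥0} (hp : 1 ≤ p) {N : ℕ} {φ : Fin N → StrongDual 𝕜 X}
    (hφ : ∀ x, ∑ n, ‖φ n x‖ ^ (p : ℝ) ≤ ‖x‖ ^ (p : ℝ)) :
    (fun n => if h : n < N then φ ⟨n, h⟩ else 0) ∈ (weak 𝕜 (StrongDual 𝕜 X) p).unitBall := by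
  have hp0 : (0 : ℝ) < p := lt_of_lt_of_le one_pos hp
  have key : ∀ ξ : StrongDual 𝕜 (StrongDual 𝕜 X),
      ∑' n, ‖ξ (if h : n < N then φ ⟨n, h⟩ else 0)‖ₑ ^ (p : ℝ) ≤ ‖ξ‖ₑ ^ (p : ℝ) := by
    intro ξ
    rw [tsum_eq_sum (s := Finset.range N), Finset.sum_range]
    · simp only [Fin.is_lt, dite_true, Fin.eta]
      rw [sum_enorm_rpow_eq_ofReal _ _ hp0.le, enorm_rpow_eq_ofReal _ hp0.le]
      exact ENNReal.ofReal_le_ofReal (StrongDual.sum_norm_bidual_rpow_le hp hφ ξ)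
    · intro n hn
      have : ¬ n < N := by simpa using hn
      simp [this, hp0]
  refine ⟨fun ξ => (key ξ).trans_lt (ENNReal.rpow_lt_top_of_nonneg hp0.le enorm_ne_top),
    iSup₂_le fun ξ hξ => ?_⟩
  rw [ENNReal.rpow_one_div_le_iff_le_rpow hp0]
  refine (key ξ).trans (ENNReal.rpow_le_rpow ?_ hp0.le)
  rw [← ofReal_norm]
  exact ENNReal.ofReal_le_one.2 hξ

theorem sum_norm_apply_rpow_le_of_mem_unitBall {p : ℝ≥0} (hp : 0 < p)
    {φ : ℕ → StrongDual 𝕜 X} (hφ : φ ∈ (weak 𝕜 (StrongDual 𝕜 X) p).unitBall) (N : ℕ) (x : X) :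
    ∑ n : Fin N, ‖φ n x‖ ^ (p : ℝ) ≤ ‖x‖ ^ (p : ℝ) := by
  have hp0 : (0 : ℝ) < p := hp
  have h1 := tsum_enorm_apply_rpow_le hp hφ.2 (NormedSpace.inclusionInDoubleDual 𝕜 X x)
  have h2 := (ENNReal.sum_le_tsum (Finset.range N)).trans h1
  rw [sum_enorm_rpow_eq_ofReal _ _ hp0.le, enorm_rpow_eq_ofReal _ hp0.le,
    ENNReal.ofReal_le_ofReal_iff (Real.rpow_nonneg (norm_nonneg _) _)] at h2
  rw [← Finset.sum_range fun n => ‖φ n x‖ ^ (p : ℝ)]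
  refine (le_of_eq ?_).trans (h2.trans (Real.rpow_le_rpow (norm_nonneg _)
    (NormedSpace.double_dual_bound 𝕜 X x) hp0.le))
  rfl

end Weak

end SeqSpace

/-! ### Mid `p`-summable sequences and their dual space -/

namespace SeqSpace

section Mid

variable {𝕜 X : Type*} [RCLike 𝕜] [NormedAddCommGroup X] [NormedSpace 𝕜 X]

theorem tsum_tsum_le_of_nrm_mid_le {p : ℝ≥0} (hp : 0 < p) {x : ℕ → X} {r : ℝ≥0∞}
    (hx : (mid 𝕜 X p).nrm x ≤ r) {φ : ℕ → StrongDual 𝕜 X}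
    (hφ : φ ∈ (weak 𝕜 (StrongDual 𝕜 X) p).unitBall) :
    ∑' n, ∑' j, ‖φ n (x j)‖ₑ ^ (p : ℝ) ≤ r ^ (p : ℝ) := by
  rw [← ENNReal.rpow_one_div_le_iff_le_rpow (NNReal.coe_pos.2 hp)]
  exact (le_iSup₂ (f := fun (φ : ℕ → StrongDual 𝕜 X)
    (_ : φ ∈ (weak 𝕜 (StrongDual 𝕜 X) p).unitBall) =>
      (∑' n, ∑' j, ‖φ n (x j)‖ₑ ^ (p : ℝ)) ^ (1 / (p : ℝ))) φ hφ).trans hx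

theorem isHomogeneous_mid {p : ℝ≥0} (hp : 0 < p) : (mid 𝕜 X p).IsHomogeneous 𝕜 := by
  intro c x
  have hp0 : (0 : ℝ) < p := hp
  simp only [mid, map_smul, enorm_smul, ENNReal.mul_rpow_of_nonneg _ _ hp0.le,
    ENNReal.tsum_mul_left, ENNReal.mul_rpow_mul_rpow_one_div hp0, ENNReal.mul_iSup]

theorem isNormed_mid {p : ℝ≥0} (hp : 1 ≤ p) : (mid 𝕜 X p).IsNormed 𝕜 where
  zero_mem φ _ := by
    have hp0 : (0 : ℝ) < p := lt_of_lt_of_le one_pos hp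
    simp [hp0]
  sub_mem x hx y hy φ hφ := by
    have hp0 : (0 : ℝ) < p := lt_of_lt_of_le one_pos hp
    have h : ∀ n j, ‖φ n (x j - y j)‖ₑ ^ (p : ℝ) ≤
        2 ^ ((p : ℝ) - 1) * (‖φ n (x j)‖ₑ ^ (p : ℝ) + ‖φ n (y j)‖ₑ ^ (p : ℝ)) := fun n j => by
      rw [map_sub]
      exact (ENNReal.rpow_le_rpow enorm_sub_le hp0.le).trans
        (ENNReal.rpow_add_le_mul_rpow_add_rpow _ _ hp)
    refine (ENNReal.tsum_le_tsum fun n => ENNReal.tsum_le_tsum fun j => h n j).trans_lt ?_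
    simp only [ENNReal.tsum_mul_left, ENNReal.tsum_add]
    exact ENNReal.mul_lt_top (ENNReal.rpow_lt_top_of_nonneg (by
      have : (1 : ℝ) ≤ p := hp
      linarith) (by simp)) (ENNReal.add_lt_top.2 ⟨hx φ hφ, hy φ hφ⟩)
  smul_mem c x hx φ hφ := by
    have hp0 : (0 : ℝ) < p := lt_of_lt_of_le one_pos hp
    simp only [map_smul, enorm_smul, ENNReal.mul_rpow_of_nonneg _ _ hp0.le,
      ENNReal.tsum_mul_left]
    exact ENNReal.mul_lt_top (ENNReal.rpow_lt_top_of_nonneg hp0.le enorm_ne_top) (hx φ hφ)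
  homogeneous := isHomogeneous_mid (lt_of_lt_of_le one_pos hp)

/-- The norm of a mid `p`-summable sequence is finite. -/
theorem nrm_mid_lt_top {p : ℝ≥0} (hp : 0 < p) {x : ℕ → X} (hx : x ∈ (mid 𝕜 X p).mem) :
    (mid 𝕜 X p).nrm x < ∞ := by
  have hp0 : (0 : ℝ) < p := hp
  by_contra h
  have htop : (mid 𝕜 X p).nrm x = ∞ := by simpa using h
  -- If the norm were infinite, test families with sums at least `2 ^ (k + 1)`, scaled by `2 ^ (-(k
  -- + 1) / p)` and merged into one sequence by the pairing function, would stay weakly `p`-summable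
  -- while each block contributes at least `1`.
  have hex : ∀ k : ℕ, ∃ φ ∈ (weak 𝕜 (StrongDual 𝕜 X) p).unitBall,
      (2 : ℝ≥0∞) ^ (k + 1) ≤ ∑' n, ∑' j, ‖φ n (x j)‖ₑ ^ (p : ℝ) := by
    intro k
    have hlt : ((2 : ℝ≥0∞) ^ (k + 1)) ^ (1 / (p : ℝ)) < (mid 𝕜 X p).nrm x := by
      rw [htop]
      exact ENNReal.rpow_lt_top_of_nonneg (one_div_pos.2 hp0).le (by simp)
    obtain ⟨φ, hφ, hlt⟩ := lt_biSup_iff.1 hlt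
    exact ⟨φ, hφ, ((ENNReal.rpow_lt_rpow_iff (one_div_pos.2 hp0)).1 hlt).le⟩
  choose φ hφ hbig using hex
  set c : ℕ → 𝕜 := fun k => (((2⁻¹ : ℝ) ^ (k + 1)) ^ (1 / (p : ℝ)) : ℝ) with hc
  have hcn : ∀ k, ‖c k‖ₑ ^ (p : ℝ) = (2⁻¹ : ℝ≥0∞) ^ (k + 1) := by
    intro k
    have h2 : (0 : ℝ) ≤ (2⁻¹ : ℝ) ^ (k + 1) := by positivity
    rw [enorm_rpow_eq_ofReal _ hp0.le, hc, RCLike.norm_ofReal,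
      abs_of_nonneg (Real.rpow_nonneg h2 _), ← Real.rpow_mul h2, one_div_mul_cancel hp0.ne',
      Real.rpow_one, ENNReal.ofReal_pow (by positivity), ENNReal.ofReal_inv_of_pos two_pos,
      ENNReal.ofReal_ofNat]
  set Φ : ℕ → StrongDual 𝕜 X := fun n =>
    c (Nat.pairEquiv.symm n).1 • φ (Nat.pairEquiv.symm n).1 (Nat.pairEquiv.symm n).2 with hΦ
  have hpair : ∀ g : ℕ × ℕ → ℝ≥0∞,
      ∑' n, g (Nat.pairEquiv.symm n) = ∑' k, ∑' m, g (k, m) := fun g => by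
    rw [Equiv.tsum_eq Nat.pairEquiv.symm g, ← ENNReal.tsum_prod]
  have hgeom : ∑' k : ℕ, (2⁻¹ : ℝ≥0∞) ^ (k + 1) = 1 := by
    rw [ENNReal.tsum_geometric_add_one, ENNReal.one_sub_inv_two, inv_inv,
      ENNReal.inv_mul_cancel two_ne_zero (by simp)]
  have hΦw : Φ ∈ (weak 𝕜 (StrongDual 𝕜 X) p).mem := by
    intro ξ
    have h1 : ∑' n, ‖ξ (Φ n)‖ₑ ^ (p : ℝ) =
        ∑' k, ∑' m, (2⁻¹ : ℝ≥0∞) ^ (k + 1) * ‖ξ (φ k m)‖ₑ ^ (p : ℝ) := by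
      rw [← hpair fun q => (2⁻¹ : ℝ≥0∞) ^ (q.1 + 1) * ‖ξ (φ q.1 q.2)‖ₑ ^ (p : ℝ)]
      refine tsum_congr fun n => ?_
      rw [hΦ]
      simp only [map_smul, enorm_smul]
      rw [ENNReal.mul_rpow_of_nonneg _ _ hp0.le, hcn]
    rw [h1]
    calc ∑' k, ∑' m, (2⁻¹ : ℝ≥0∞) ^ (k + 1) * ‖ξ (φ k m)‖ₑ ^ (p : ℝ)
        ≤ ∑' k : ℕ, (2⁻¹ : ℝ≥0∞) ^ (k + 1) * ‖ξ‖ₑ ^ (p : ℝ) := by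
          refine ENNReal.tsum_le_tsum fun k => ?_
          rw [ENNReal.tsum_mul_left]
          exact mul_le_mul_right (tsum_enorm_apply_rpow_le hp (hφ k).2 ξ) _
      _ = ‖ξ‖ₑ ^ (p : ℝ) := by rw [ENNReal.tsum_mul_right, hgeom, one_mul]
      _ < ∞ := ENNReal.rpow_lt_top_of_nonneg hp0.le enorm_ne_top
  refine (hx Φ hΦw).ne (top_unique ?_)
  have h1 : ∑' n, ∑' j, ‖Φ n (x j)‖ₑ ^ (p : ℝ) =
      ∑' k, ∑' m, (2⁻¹ : ℝ≥0∞) ^ (k + 1) * ∑' j, ‖φ k m (x j)‖ₑ ^ (p : ℝ) := by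
    rw [← hpair fun q => (2⁻¹ : ℝ≥0∞) ^ (q.1 + 1) * ∑' j, ‖φ q.1 q.2 (x j)‖ₑ ^ (p : ℝ)]
    refine tsum_congr fun n => ?_
    rw [← ENNReal.tsum_mul_left]
    refine tsum_congr fun j => ?_
    rw [hΦ]
    simp only [smul_apply, enorm_smul]
    rw [ENNReal.mul_rpow_of_nonneg _ _ hp0.le, hcn]
  rw [h1]
  calc (∞ : ℝ≥0∞) = ∑' _ : ℕ, (1 : ℝ≥0∞) := (ENNReal.tsum_const_eq_top_of_ne_zero one_ne_zero).symm
    _ ≤ _ := by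
      refine ENNReal.tsum_le_tsum fun k => ?_
      rw [ENNReal.tsum_mul_left]
      refine le_trans (le_of_eq ?_) (mul_le_mul_right (hbig k) _)
      rw [← mul_pow, ENNReal.inv_mul_cancel two_ne_zero (by simp), one_pow]

theorem sum_sum_norm_apply_le_of_nrm_mid_le {p : ℝ≥0} (hp : 1 ≤ p) {x : ℕ → X}
    (hx : (mid 𝕜 X p).nrm x ≤ 1) {N : ℕ} {φ : Fin N → StrongDual 𝕜 X}
    (hφ : ∀ x, ∑ n, ‖φ n x‖ ^ (p : ℝ) ≤ ‖x‖ ^ (p : ℝ)) (M : ℕ) :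
    ∑ n, ∑ i : Fin M, ‖φ n (x i)‖ ^ (p : ℝ) ≤ 1 := by
  have hp0 : (0 : ℝ) < p := lt_of_lt_of_le one_pos hp
  have h := tsum_tsum_le_of_nrm_mid_le (lt_of_lt_of_le one_pos hp) hx
    (mem_weak_unitBall_of_fin hp hφ)
  rw [ENNReal.one_rpow] at h
  have h2 := (ENNReal.sum_le_tsum (Finset.range N)).trans h
  rw [Finset.sum_range] at h2
  simp only [Fin.is_lt, dite_true, Fin.eta] at h2
  have h3 : ∑ n, ∑ i : Fin M, ‖φ n (x i)‖ₑ ^ (p : ℝ) ≤ 1 := by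
    refine le_trans (Finset.sum_le_sum fun n _ => ?_) h2
    rw [← Finset.sum_range fun i => ‖φ n (x i)‖ₑ ^ (p : ℝ)]
    exact ENNReal.sum_le_tsum _
  simp only [sum_enorm_rpow_eq_ofReal _ _ hp0.le] at h3
  rw [← ENNReal.ofReal_sum_of_nonneg fun n _ => Finset.sum_nonneg fun i _ =>
    Real.rpow_nonneg (norm_nonneg _) _] at h3
  exact ENNReal.ofReal_le_one.1 h3

section FiniteSupport

variable {x : ℕ → X} {M : ℕ}

theorem mem_mid_of_finite_support {p : ℝ≥0} (hp : 0 < p) (hx : ∀ j, M ≤ j → x j = 0) :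
    x ∈ (mid 𝕜 X p).mem := by
  have hp0 : (0 : ℝ) < p := hp
  intro φ hφ
  -- After the exchange only finitely many `j` matter, and each inner sum is weak summability of `φ`
  -- tested at the image of `x j` in the bidual.
  rw [ENNReal.tsum_comm, tsum_eq_sum (s := Finset.range M)]
  · refine ENNReal.sum_lt_top.2 fun j _ => ?_
    exact hφ (NormedSpace.inclusionInDoubleDual 𝕜 X (x j))
  · intro j hj
    simp [hx j (by simpa using hj), hp0]

theorem nrm_mid_le_of_finite_support {p : ℝ≥0} (hp : 0 < p) (hx : ∀ j, M ≤ j → x j = 0)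
    {r : ℝ} (hr : 0 ≤ r)
    (h : ∀ (N : ℕ) (φ : Fin N → StrongDual 𝕜 X),
      (∀ x, ∑ n, ‖φ n x‖ ^ (p : ℝ) ≤ ‖x‖ ^ (p : ℝ)) →
      ∑ n, ∑ i : Fin M, ‖φ n (x i)‖ ^ (p : ℝ) ≤ r ^ (p : ℝ)) :
    (mid 𝕜 X p).nrm x ≤ ENNReal.ofReal r := by
  have hp0 : (0 : ℝ) < p := hp
  refine iSup₂_le fun φ hφ => ?_
  rw [ENNReal.rpow_one_div_le_iff_le_rpow hp0]
  refine ENNReal.tsum_le_of_sum_range_le fun N => ?_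
  have h1 := h N (fun n => φ n) (sum_norm_apply_rpow_le_of_mem_unitBall hp hφ N)
  have h2 : ∀ n, ∑' j, ‖φ n (x j)‖ₑ ^ (p : ℝ) =
      ENNReal.ofReal (∑ i : Fin M, ‖φ n (x i)‖ ^ (p : ℝ)) := by
    intro n
    rw [tsum_eq_sum (s := Finset.range M), Finset.sum_range, sum_enorm_rpow_eq_ofReal _ _ hp0.le]
    intro j hj
    simp [hx j (by simpa using hj), hp0]
  simp only [h2]
  rw [← ENNReal.ofReal_sum_of_nonneg fun n _ => Finset.sum_nonneg fun i _ =>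
    Real.rpow_nonneg (norm_nonneg _) _, ENNReal.ofReal_rpow_of_nonneg hr hp0.le, Finset.sum_range]
  exact ENNReal.ofReal_le_ofReal h1

end FiniteSupport

theorem isHomogeneous_midDual (p : ℝ≥0) : (midDual 𝕜 X p).IsHomogeneous 𝕜 := by
  intro c x
  simp only [midDual, map_smul, enorm_smul, ENNReal.tsum_mul_left, ENNReal.mul_iSup]

theorem mem_midDual_of_nrm_lt_top {p : ℝ≥0} (hp : 1 ≤ p) {x : ℕ → X}
    (hx : (midDual 𝕜 X p).nrm x < ∞) : x ∈ (midDual 𝕜 X p).mem := by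
  intro φ hφ
  have hfin := nrm_mid_lt_top (lt_of_lt_of_le one_pos hp) hφ
  obtain ⟨c, hc, hcφ⟩ := ENNReal.exists_nnreal_pos_mul_lt hfin.ne one_ne_zero
  have hcn : ‖((c : ℝ) : 𝕜)‖ₑ = c := by
    rw [← ofReal_norm, RCLike.norm_ofReal, NNReal.abs_eq, ENNReal.ofReal_coe_nnreal]
  have hmem : (fun j => ((c : ℝ) : 𝕜) • φ j) ∈ (mid 𝕜 (StrongDual 𝕜 X) p).unitBall := by
    refine ⟨(isNormed_mid hp).smul_mem _ φ hφ, ?_⟩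
    rw [(isNormed_mid hp).homogeneous, hcn]
    exact hcφ.le
  have h1 := (le_iSup₂ (f := fun (φ : ℕ → StrongDual 𝕜 X)
    (_ : φ ∈ (mid 𝕜 (StrongDual 𝕜 X) p).unitBall) => ∑' j, ‖φ j (x j)‖ₑ) _ hmem).trans_lt hx
  simp only [smul_apply, enorm_smul, hcn, ENNReal.tsum_mul_left] at h1
  exact (ENNReal.lt_top_of_mul_ne_top_right h1.ne (by exact_mod_cast hc.ne'))

end Mid

end SeqSpace

/-! ### Conjugate exponents and the duality of `ℓ_p(X*)` with `ℓ_q(X)` -/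

theorem ENNReal.conj_exponent_cases {p : ℝ≥0} {q : ℝ≥0∞} (hp : 1 ≤ p)
    (hpq : (p : ℝ≥0∞)⁻¹ + q⁻¹ = 1) :
    (p = 1 ∧ q = ∞) ∨ (q ≠ ∞ ∧ (p : ℝ).HolderConjugate q.toReal) := by
  have hp0 : p ≠ 0 := (lt_of_lt_of_le one_pos hp).ne'
  rcases hp.eq_or_lt with rfl | h1
  · left
    refine ⟨rfl, ?_⟩
    have : (1 : ℝ≥0∞) + q⁻¹ = 1 + 0 := by simpa using hpq
    exact ENNReal.inv_eq_zero.1 ((ENNReal.add_right_inj ENNReal.one_ne_top).1 this)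
  · right
    have hq0 : q ≠ 0 := by
      rintro rfl
      simp at hpq
    have hqt : q ≠ ∞ := by
      rintro rfl
      have h2 : (p : ℝ≥0∞) = 1 := by simpa using hpq
      exact h1.ne' (by exact_mod_cast h2)
    refine ⟨hqt, Real.holderConjugate_iff.2 ⟨by exact_mod_cast h1, ?_⟩⟩
    have h2 := congrArg ENNReal.toReal hpq
    rwa [ENNReal.toReal_add (ENNReal.inv_ne_top.2 (by exact_mod_cast hp0))
      (ENNReal.inv_ne_top.2 hq0), ENNReal.toReal_inv, ENNReal.toReal_inv, ENNReal.coe_toReal,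
      ENNReal.toReal_one] at h2

namespace SeqSpace

/-- Hölder's inequality for the norms of `ℓ_p` and `ℓ_q`. -/
theorem tsum_enorm_mul_enorm_le {X Y : Type*} [NormedAddCommGroup X] [NormedAddCommGroup Y]
    {p : ℝ≥0} {q : ℝ≥0∞} (hp : 1 ≤ p) (hpq : (p : ℝ≥0∞)⁻¹ + q⁻¹ = 1) (x : ℕ → X) (y : ℕ → Y) :
    ∑' j, ‖x j‖ₑ * ‖y j‖ₑ ≤ (strong p X).nrm x * (strong q Y).nrm y := by
  rw [nrm_strong_coe]
  rcases ENNReal.conj_exponent_cases hp hpq with ⟨rfl, rfl⟩ | ⟨hq, h⟩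
  · simp only [NNReal.coe_one, ENNReal.rpow_one, one_div, inv_one, strong, if_true]
    rw [← ENNReal.tsum_mul_right]
    exact ENNReal.tsum_le_tsum fun j => mul_le_mul_right (le_iSup (fun j => ‖y j‖ₑ) j) _
  · have := ENNReal.lintegral_mul_le_Lp_mul_Lq (MeasureTheory.Measure.count (α := ℕ)) h
      (f := fun j => ‖x j‖ₑ) (g := fun j => ‖y j‖ₑ) (by fun_prop) (by fun_prop)
    simpa only [MeasureTheory.lintegral_count, Pi.mul_apply, strong, if_neg hq] using this

section Dual

variable {𝕜 X : Type*} [RCLike 𝕜] [NormedAddCommGroup X] [NormedSpace 𝕜 X]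

theorem tsum_enorm_apply_le {p : ℝ≥0} {q : ℝ≥0∞} (hp : 1 ≤ p) (hpq : (p : ℝ≥0∞)⁻¹ + q⁻¹ = 1)
    (g : ℕ → StrongDual 𝕜 X) (x : ℕ → X) :
    ∑' j, ‖g j (x j)‖ₑ ≤ (strong p (StrongDual 𝕜 X)).nrm g * (strong q X).nrm x :=
  (ENNReal.tsum_le_tsum fun j => (g j).le_opENorm (x j)).trans
    (tsum_enorm_mul_enorm_le hp hpq g x)

theorem exists_norm_le_one_mul_norm_le (f : StrongDual 𝕜 X) {θ : ℝ} (hθ : θ < 1) :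
    ∃ x : X, ‖x‖ ≤ 1 ∧ θ * ‖f‖ ≤ ‖f x‖ := by
  rcases (norm_nonneg f).eq_or_lt with h | h
  · exact ⟨0, by simp, by simp [← h]⟩
  · obtain ⟨x, hx, hfx⟩ := f.exists_lt_apply_of_lt_opNorm
      (show θ * ‖f‖ < ‖f‖ from mul_lt_of_lt_one_left h hθ)
    exact ⟨x, hx.le, hfx.le⟩

theorem mem_strong_unitBall_of_rpow {p : ℝ≥0} {q : ℝ≥0∞} (hp : 1 ≤ p)
    (hpq : (p : ℝ≥0∞)⁻¹ + q⁻¹ = 1) {M : ℕ} {t : Fin M → ℝ} (ht : ∀ i, 0 ≤ t i)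
    (ht1 : ∑ i, t i ^ (p : ℝ) ≤ 1) {x : Fin M → X} (hx : ∀ i, ‖x i‖ ≤ 1) :
    (fun j => if h : j < M then ((t ⟨j, h⟩ ^ ((p : ℝ) - 1) : ℝ) : 𝕜) • x ⟨j, h⟩ else 0) ∈
      (strong q X).unitBall := by
  have hq0 : q ≠ 0 := by
    rintro rfl
    simp at hpq
  suffices H : (strong q X).nrm (fun j => if h : j < M then
      ((t ⟨j, h⟩ ^ ((p : ℝ) - 1) : ℝ) : 𝕜) • x ⟨j, h⟩ else 0) ≤ 1 from
    ⟨(mem_strong_iff hq0).2 (H.trans_lt ENNReal.one_lt_top), H⟩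
  have hn : ∀ i : Fin M, ‖((t i ^ ((p : ℝ) - 1) : ℝ) : 𝕜) • x i‖ ≤ t i ^ ((p : ℝ) - 1) := by
    intro i
    rw [norm_smul, RCLike.norm_ofReal, abs_of_nonneg (Real.rpow_nonneg (ht i) _)]
    exact mul_le_of_le_one_right (Real.rpow_nonneg (ht i) _) (hx i)
  rcases ENNReal.conj_exponent_cases hp hpq with ⟨rfl, rfl⟩ | ⟨hq, h⟩
  · simp only [strong, if_true]
    refine iSup_le fun j => ?_
    split_ifs with hj
    · rw [← ofReal_norm]
      refine ENNReal.ofReal_le_one.2 ((hn ⟨j, hj⟩).trans ?_)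
      simp
    · simp
  · have hQ := h.symm.pos
    simp only [strong, if_neg hq]
    rw [ENNReal.rpow_one_div_le_iff_le_rpow hQ, ENNReal.one_rpow,
      tsum_eq_sum (s := Finset.range M), Finset.sum_range]
    · simp only [Fin.is_lt, dite_true, Fin.eta]
      rw [sum_enorm_rpow_eq_ofReal _ _ hQ.le]
      refine ENNReal.ofReal_le_one.2 ((Finset.sum_le_sum fun i _ => ?_).trans ht1)
      refine (Real.rpow_le_rpow (norm_nonneg _) (hn i) hQ.le).trans (le_of_eq ?_)
      rw [← Real.rpow_mul (ht i), h.sub_one_mul_conj]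
    · intro j hj
      have : ¬ j < M := by simpa using hj
      simp [this, hQ]

/-- The norm of `ℓ_p(X*)` is dual to the norm of `ℓ_q(X)`. -/
theorem iSup_tsum_enorm_apply_eq_nrm_strong {p : ℝ≥0} {q : ℝ≥0∞} (hp : 1 ≤ p)
    (hpq : (p : ℝ≥0∞)⁻¹ + q⁻¹ = 1) (g : ℕ → StrongDual 𝕜 X) :
    ⨆ x ∈ (strong q X).unitBall, ∑' j, ‖g j (x j)‖ₑ = (strong p (StrongDual 𝕜 X)).nrm g := by
  have hp0 : (0 : ℝ) < p := lt_of_lt_of_le one_pos hp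
  refine le_antisymm (iSup₂_le fun x hx => (tsum_enorm_apply_le hp hpq g x).trans
    (mul_le_of_le_one_right' hx.2)) ?_
  set S := ⨆ x ∈ (strong q X).unitBall, ∑' j, ‖g j (x j)‖ₑ with hS
  rcases eq_or_ne S ∞ with htop | htop
  · rw [htop]
    exact le_top
  rw [nrm_strong_coe, ENNReal.rpow_one_div_le_iff_le_rpow hp0]
  refine ENNReal.tsum_le_of_sum_range_le fun M => ?_
  rw [Finset.sum_range, ← ENNReal.rpow_one_div_le_iff_le_rpow hp0,
    sum_enorm_rpow_eq_ofReal _ _ hp0.le]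
  have hA0 : 0 ≤ ∑ i : Fin M, ‖g i‖ ^ (p : ℝ) :=
    Finset.sum_nonneg fun i _ => Real.rpow_nonneg (norm_nonneg _) _
  rw [ENNReal.ofReal_rpow_of_nonneg hA0 (one_div_pos.2 hp0).le]
  refine ENNReal.ofReal_le_of_le_toReal ?_
  obtain ⟨t, ht, ht1, hta⟩ := Real.exists_sum_mul_rpow_sub_one_eq (p := p) hp
    fun i : Fin M => norm_nonneg (g i)
  set A := (∑ i : Fin M, ‖g i‖ ^ (p : ℝ)) ^ (1 / (p : ℝ)) with hA
  -- The functionals `g i` need not attain their norms, hence the loss `θ`; the test sequence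
  -- consists of almost norming vectors with coefficients `t i ^ (p - 1)`.
  have key : ∀ θ : ℝ, θ < 1 → θ * A ≤ S.toReal := by
    intro θ hθ
    choose x hx hgx using fun i : Fin M => exists_norm_le_one_mul_norm_le (g i) hθ
    have h1 := le_iSup₂ (f := fun (x : ℕ → X) (_ : x ∈ (strong q X).unitBall) =>
      ∑' j, ‖g j (x j)‖ₑ) _ (mem_strong_unitBall_of_rpow (𝕜 := 𝕜) hp hpq ht ht1 hx)
    have h2 := (ENNReal.sum_le_tsum (Finset.range M)).trans h1
    rw [Finset.sum_range] at h2
    simp only [Fin.is_lt, dite_true, Fin.eta] at h2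
    have h3 := ENNReal.toReal_mono htop h2
    rw [ENNReal.toReal_sum fun i _ => enorm_ne_top] at h3
    refine le_trans ?_ h3
    rw [← hta, Finset.mul_sum]
    refine Finset.sum_le_sum fun i _ => ?_
    rw [toReal_enorm, map_smul, norm_smul, RCLike.norm_ofReal,
      abs_of_nonneg (Real.rpow_nonneg (ht i) _)]
    have := mul_le_mul_of_nonneg_left (hgx i) (Real.rpow_nonneg (ht i) ((p : ℝ) - 1))
    linarith
  by_contra! hlt
  obtain ⟨B, hB1, hB2⟩ := exists_between hlt
  have hA1 : 0 < A := ENNReal.toReal_nonneg.trans_lt hlt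
  have := key (B / A) ((div_lt_one hA1).2 hB2)
  rw [div_mul_cancel₀ _ hA1.ne'] at this
  linarith

end Dual

/-! ### Operator norms and the adjoint -/

section Operators

variable {𝕜 X Y : Type*} [RCLike 𝕜] [NormedAddCommGroup X] [NormedSpace 𝕜 X]
  [NormedAddCommGroup Y] [NormedSpace 𝕜 Y]

theorem isAbsMidSumming_iff {p : ℝ≥0} (hp : 1 ≤ p) (T : X →L[𝕜] Y) :
    IsAbsMidSumming p T ↔ piMid p T < ∞ := by
  have hp0 : (p : ℝ≥0∞) ≠ 0 := by exact_mod_cast (lt_of_lt_of_le one_pos hp).ne'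
  exact inducesContinuous_iff (isNormed_mid hp)
    (fun x hx => nrm_mid_lt_top (lt_of_lt_of_le one_pos hp) hx) (isHomogeneous_strong 𝕜 hp0)
    (fun y hy => (mem_strong_iff hp0).2 hy) T

theorem inducesContinuous_strong_midDual_iff {p : ℝ≥0} {q : ℝ≥0∞} (hp : 1 ≤ p) (hq : q ≠ 0)
    (T : X →L[𝕜] Y) :
    (strong q X).InducesContinuous (midDual 𝕜 Y p) T ↔
      (strong q X).opNorm (midDual 𝕜 Y p) T < ∞ :=
  inducesContinuous_iff (isNormed_strong 𝕜 hq) (fun _ hx => (mem_strong_iff hq).1 hx)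
    (isHomogeneous_midDual p) (fun _ hy => mem_midDual_of_nrm_lt_top hp hy) T

theorem opNorm_strong_midDual_eq {p : ℝ≥0} {q : ℝ≥0∞} (hp : 1 ≤ p)
    (hpq : (p : ℝ≥0∞)⁻¹ + q⁻¹ = 1) (T : X →L[𝕜] Y) :
    (strong q X).opNorm (midDual 𝕜 Y p) T = piMid p (banachAdjoint T) := by
  have h : ∀ φ : ℕ → StrongDual 𝕜 Y,
      (strong p (StrongDual 𝕜 X)).nrm (fun j => banachAdjoint T (φ j)) =
        ⨆ x ∈ (strong q X).unitBall, ∑' j, ‖φ j (T (x j))‖ₑ := fun φ =>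
    (iSup_tsum_enorm_apply_eq_nrm_strong hp hpq fun j => banachAdjoint T (φ j)).symm
  simp only [piMid, opNorm, h, midDual]
  -- Both sides are suprema of `∑ ‖φ j (T (x j))‖` over the same two unit balls, in opposite order.
  exact iSup₂_comm _

end Operators

end SeqSpace

/-! ### Invariance of the mid summing norm under the biadjoint -/

namespace SeqSpace

section Bidual

variable {𝕜 X Y : Type*} [RCLike 𝕜] [NormedAddCommGroup X] [NormedSpace 𝕜 X]
  [NormedAddCommGroup Y] [NormedSpace 𝕜 Y]

theorem map_mem_weak {p : ℝ≥0} (S : X →L[𝕜] Y) {x : ℕ → X} (hx : x ∈ (weak 𝕜 X p).mem) :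
    (fun j => S (x j)) ∈ (weak 𝕜 Y p).mem :=
  fun φ => hx (φ.comp S)

theorem map_mem_weak_unitBall {p : ℝ≥0} {S : X →L[𝕜] Y} (hS : ‖S‖ ≤ 1) {x : ℕ → X}
    (hx : x ∈ (weak 𝕜 X p).unitBall) : (fun j => S (x j)) ∈ (weak 𝕜 Y p).unitBall := by
  refine ⟨map_mem_weak S hx.1, iSup₂_le fun φ hφ => le_trans ?_ hx.2⟩
  exact le_iSup₂ (f := fun (φ : StrongDual 𝕜 X) (_ : ‖φ‖ ≤ 1) =>
    (∑' j, ‖φ (x j)‖ₑ ^ (p : ℝ)) ^ (1 / (p : ℝ))) (φ.comp S)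
    ((φ.opNorm_comp_le S).trans (mul_le_one₀ hφ (norm_nonneg _) hS))

theorem norm_banachAdjoint_le (T : X →L[𝕜] Y) : ‖banachAdjoint T‖ ≤ ‖T‖ :=
  ContinuousLinearMap.opNorm_le_bound _ (norm_nonneg _) fun φ =>
    (φ.opNorm_comp_le T).trans (le_of_eq (mul_comm _ _))

theorem map_mem_mid_unitBall {p : ℝ≥0} {S : X →L[𝕜] Y} (hS : ‖S‖ ≤ 1) {x : ℕ → X}
    (hx : x ∈ (mid 𝕜 X p).unitBall) : (fun j => S (x j)) ∈ (mid 𝕜 Y p).unitBall := by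
  refine ⟨fun φ hφ => hx.1 _ (map_mem_weak (banachAdjoint S) hφ),
    iSup₂_le fun φ hφ => le_trans ?_ hx.2⟩
  exact le_iSup₂ (f := fun (φ : ℕ → StrongDual 𝕜 X)
    (_ : φ ∈ (weak 𝕜 (StrongDual 𝕜 X) p).unitBall) =>
      (∑' n, ∑' j, ‖φ n (x j)‖ₑ ^ (p : ℝ)) ^ (1 / (p : ℝ))) _
    (map_mem_weak_unitBall ((norm_banachAdjoint_le S).trans hS) hφ)

theorem piMid_le_of_norm_map_eq {V W : Type*} [NormedAddCommGroup V] [NormedSpace 𝕜 V]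
    [NormedAddCommGroup W] [NormedSpace 𝕜 W] {p : ℝ≥0} {T : X →L[𝕜] Y} {R : V →L[𝕜] W}
    {S : X →L[𝕜] V} (hS : ‖S‖ ≤ 1) (h : ∀ x, ‖R (S x)‖ = ‖T x‖) : piMid p T ≤ piMid p R := by
  refine iSup₂_le fun x hx => ?_
  refine le_trans (le_of_eq ?_) (le_iSup₂ (f := fun (v : ℕ → V)
    (_ : v ∈ (mid 𝕜 V p).unitBall) => (strong p W).nrm fun j => R (v j)) _
    (map_mem_mid_unitBall hS hx))
  have he : ∀ j, ‖R (S (x j))‖ₑ = ‖T (x j)‖ₑ := fun j => by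
    rw [← ofReal_norm, h, ofReal_norm]
  simp only [nrm_strong_coe, he]

theorem norm_banachAdjoint_banachAdjoint_inclusion (T : X →L[𝕜] Y) (x : X) :
    ‖banachAdjoint (banachAdjoint T) (NormedSpace.inclusionInDoubleDual 𝕜 X x)‖ = ‖T x‖ :=
  (NormedSpace.inclusionInDoubleDualLi 𝕜 (E := Y)).norm_map (T x)

theorem piMid_le_piMid_banachAdjoint_banachAdjoint {p : ℝ≥0} (T : X →L[𝕜] Y) :
    piMid p T ≤ piMid p (banachAdjoint (banachAdjoint T)) :=
  piMid_le_of_norm_map_eq (NormedSpace.inclusionInDoubleDual_norm_le 𝕜 X)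
    (norm_banachAdjoint_banachAdjoint_inclusion T)

/-- Extending `z` by zero gives a mid summable sequence of norm at most `r`; Hölder then pairs its
image in `ℓ_p(Y)` with `y` in `ℓ_q(Y*)`. This supplies the hypothesis of `norm_sum_bidual_apply_le`.
-/
theorem norm_sum_apply_map_le {p : ℝ≥0} {q : ℝ≥0∞} (hp : 1 ≤ p)
    (hpq : (p : ℝ≥0∞)⁻¹ + q⁻¹ = 1) {T : X →L[𝕜] Y} (hT : piMid p T ≠ ∞) {M : ℕ}
    {y : ℕ → StrongDual 𝕜 Y} (hy : (strong q (StrongDual 𝕜 Y)).nrm y ≤ 1) {r : ℝ} (hr : 0 < r)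
    (z : Fin M → X)
    (hz : ∀ (N : ℕ) (φ : Fin N → StrongDual 𝕜 X),
      (∀ x, ∑ n, ‖φ n x‖ ^ (p : ℝ) ≤ ‖x‖ ^ (p : ℝ)) →
      ∑ n, ∑ i, ‖φ n (z i)‖ ^ (p : ℝ) ≤ r ^ (p : ℝ)) :
    ∑ i : Fin M, ‖y i (T (z i))‖ ≤ (piMid p T).toReal * r := by
  have hp0 : 0 < p := lt_of_lt_of_le one_pos hp
  have hpe : (p : ℝ≥0∞) ≠ 0 := by exact_mod_cast hp0.ne'
  set x : ℕ → X := fun j => if h : j < M then z ⟨j, h⟩ else 0 with hx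
  have hx0 : ∀ j, M ≤ j → x j = 0 := fun j hj => by simp [hx, not_lt.2 hj]
  have hxz : ∀ i : Fin M, x i = z i := fun i => by simp [hx]
  have h1 : (mid 𝕜 X p).nrm x ≤ ENNReal.ofReal r :=
    nrm_mid_le_of_finite_support hp0 hx0 hr.le fun N φ hφ => by
      simpa only [hxz] using hz N φ hφ
  have h2 : (strong p Y).nrm (fun j => T (x j)) ≤ ENNReal.ofReal r * piMid p T :=
    nrm_map_le (isNormed_mid hp) (isHomogeneous_strong 𝕜 hpe) T
      (mem_mid_of_finite_support hp0 hx0) hr h1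
  have h3 : ∑' j, ‖y j (T (x j))‖ₑ ≤ ENNReal.ofReal r * piMid p T := by
    refine (ENNReal.tsum_le_tsum fun j => ((y j).le_opENorm (T (x j))).trans_eq
      (mul_comm _ _)).trans ((tsum_enorm_mul_enorm_le hp hpq _ _).trans ?_)
    exact (mul_le_of_le_one_right' hy).trans h2
  have h4 := (ENNReal.sum_le_tsum (Finset.range M)).trans h3
  rw [Finset.sum_range] at h4
  have h5 := ENNReal.toReal_mono (ENNReal.mul_ne_top ENNReal.ofReal_ne_top hT) h4
  rw [ENNReal.toReal_sum fun i _ => enorm_ne_top, ENNReal.toReal_mul,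
    ENNReal.toReal_ofReal hr.le, mul_comm] at h5
  simpa only [toReal_enorm, hxz] using h5

theorem piMid_banachAdjoint_banachAdjoint {p : ℝ≥0} {q : ℝ≥0∞} (hp : 1 ≤ p)
    (hpq : (p : ℝ≥0∞)⁻¹ + q⁻¹ = 1) (T : X →L[𝕜] Y) :
    piMid p (banachAdjoint (banachAdjoint T)) = piMid p T := by
  refine le_antisymm ?_ (piMid_le_piMid_banachAdjoint_banachAdjoint T)
  rcases eq_or_ne (piMid p T) ∞ with htop | htop
  · rw [htop]
    exact le_top
  refine iSup₂_le fun ξ hξ => ?_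
  rw [← iSup_tsum_enorm_apply_eq_nrm_strong hp hpq]
  refine iSup₂_le fun y hy => ENNReal.tsum_le_of_sum_range_le fun M => ?_
  choose s hs1 hs using fun i : Fin M => RCLike.exists_norm_one_mul_eq (ξ i (banachAdjoint T (y i)))
  -- The phases `s i` turn the sum of absolute values into the absolute value of a sum, and `ε`
  -- keeps the constant positive when `piMid p T = 0`. The mid norm of `ξ` is tested only on the
  -- images of `ψ n` in `X***`.
  have key : ∀ ε : ℝ, 0 < ε →
      ‖∑ i : Fin M, ξ i (s i • banachAdjoint T (y i))‖ ≤ (piMid p T).toReal + ε := by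
    intro ε hε
    refine norm_sum_bidual_apply_le (p := p) hp (add_pos_of_nonneg_of_pos ENNReal.toReal_nonneg hε)
      (fun z r hr hz => ?_)
      fun N ψ hψ => sum_sum_norm_apply_le_of_nrm_mid_le hp hξ.2 (φ := fun n =>
        NormedSpace.inclusionInDoubleDual 𝕜 (StrongDual 𝕜 X) (ψ n))
        (StrongDual.sum_norm_bidual_rpow_le hp hψ) M
    calc ‖∑ i : Fin M, (s i • banachAdjoint T (y i)) (z i)‖
        ≤ ∑ i : Fin M, ‖y i (T (z i))‖ := by
          refine (norm_sum_le _ _).trans (le_of_eq (Finset.sum_congr rfl fun i _ => ?_))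
          rw [smul_apply, norm_smul, hs1, one_mul]
          rfl
      _ ≤ (piMid p T).toReal * r := norm_sum_apply_map_le hp hpq htop hy.2 hr z hz
      _ ≤ ((piMid p T).toReal + ε) * r :=
          mul_le_mul_of_nonneg_right (by linarith) hr.le
  have h1 : ∑ i : Fin M, ξ i (s i • banachAdjoint T (y i)) =
      ((∑ i : Fin M, ‖ξ i (banachAdjoint T (y i))‖ : ℝ) : 𝕜) := by
    push_cast
    exact Finset.sum_congr rfl fun i _ => by rw [map_smul, smul_eq_mul, hs]
  have h2 := le_of_forall_pos_le_add key
  rw [h1, RCLike.norm_ofReal, abs_of_nonneg (Finset.sum_nonneg fun i _ => norm_nonneg _)] at h2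
  have h3 : ∑ j ∈ Finset.range M, ‖(banachAdjoint (banachAdjoint T) (ξ j)) (y j)‖ₑ =
      ENNReal.ofReal (∑ i : Fin M, ‖ξ i (banachAdjoint T (y i))‖) := by
    rw [Finset.sum_range, ENNReal.ofReal_sum_of_nonneg fun i _ => norm_nonneg _]
    refine Finset.sum_congr rfl fun i _ => ?_
    rw [ofReal_norm]
    rfl
  rw [h3]
  exact ENNReal.ofReal_le_of_le_toReal h2

end Bidual

end SeqSpace

theorem mainTheorem5 {𝕜 : Type*} [RCLike 𝕜]
    {X : Type*} [NormedAddCommGroup X] [NormedSpace 𝕜 X] [CompleteSpace X]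
    {Y : Type*} [NormedAddCommGroup Y] [NormedSpace 𝕜 Y] [CompleteSpace Y]
    (p : ℝ≥0) (q : ℝ≥0∞) (hp : 1 ≤ p) (hpq : (p : ℝ≥0∞)⁻¹ + q⁻¹ = 1)
    (T : X →L[𝕜] Y) :
    (((SeqSpace.strong q (StrongDual 𝕜 Y)).InducesContinuous
          (SeqSpace.midDual 𝕜 (StrongDual 𝕜 X) p) (banachAdjoint T) ↔ IsAbsMidSumming p T) ∧
      (IsAbsMidSumming p T →
        piMid p T = (SeqSpace.strong q (StrongDual 𝕜 Y)).opNorm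
          (SeqSpace.midDual 𝕜 (StrongDual 𝕜 X) p) (banachAdjoint T) ∧ piMid p T < ∞)) ∧
    (((SeqSpace.strong q X).InducesContinuous
          (SeqSpace.midDual 𝕜 Y p) T ↔ IsAbsMidSumming p (banachAdjoint T)) ∧
      (IsAbsMidSumming p (banachAdjoint T) →
        piMid p (banachAdjoint T) = (SeqSpace.strong q X).opNorm
          (SeqSpace.midDual 𝕜 Y p) T ∧ piMid p (banachAdjoint T) < ∞)) := by
  have hq : q ≠ 0 := by
    rintro rfl
    simp at hpq
  have hbi := SeqSpace.piMid_banachAdjoint_banachAdjoint hp hpq T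
  have hop1 := SeqSpace.opNorm_strong_midDual_eq hp hpq (banachAdjoint T)
  have hop2 := SeqSpace.opNorm_strong_midDual_eq hp hpq T
  rw [SeqSpace.inducesContinuous_strong_midDual_iff hp hq,
    SeqSpace.inducesContinuous_strong_midDual_iff hp hq, SeqSpace.isAbsMidSumming_iff hp,
    SeqSpace.isAbsMidSumming_iff hp, hop1, hop2, hbi]
  exact ⟨⟨Iff.rfl, fun h => ⟨rfl, h⟩⟩, ⟨Iff.rfl, fun h => ⟨rfl, h⟩⟩⟩
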